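/- Throughout, $n_1,n_2,n_3$ and the sample size $n$ are positive integers, $d:=n_1n_2n_3$, and $\mathbb R^{n_1\times n_2\times n_3}$ carries the inner product $\langle\mathcal A,\mathcal B\rangle=\sum_{i,j,k}\mathcal A_{ijk}\mathcal B_{ijk}$ with Frobenius norm $\|\cdot\|_F$; $\|\mathcal A\|_\infty=\max_{i,j,k}|\mathcal A_{ijk}|$. Let $\mathbf U\in\mathbb C^{n_3\times n_3}$ be unitary. For $\mathcal X\in\mathbb R^{n_1\times n_2\times n_3}$ let $\widehat{\mathcal X}_{\mathbf U}^{\langle k\rangle}\in\mathbb C^{n_1\times n_2}$, $1\le k\le n_3$, be the matrix with entries $\sum_{l}\mathbf U_{kl}\mathcal X_{ijl}$ (the $k$-th transformed frontal slice). With $\sigma_1\ge\sigma_2\ge\cdots$ denoting singular values, put $$\|\mathcal X\|_{\mathrm{TTNN}}=\sum_{k=1}^{n_3}\sum_{j=1}^{\min\{n_1,n_2\}}\sigma_j\big(\widehat{\mathcal X}_{\mathbf U}^{\langle k\rangle}\big),\qquad \|\mathcal X\|_{\mathbf U}=\sigma_1\Big(\mathrm{bdiag}\big(\widehat{\mathcal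 X}_{\mathbf U}^{\langle 1\rangle},\dots,\widehat{\mathcal X}_{\mathbf U}^{\langle n_3\rangle}\big)\Big).$$ **Penalty.** Let $\lambda\in\mathbb R$, $k_0>0$, $\mu>0$, and let $g_\lambda:\mathbb R\to[0,\infty)$ be even and continuous at $0$, such that: (i) $g_\lambda$ is concave and non-decreasing on $[0,\infty)$ with $g_\lambda(0)=0$; (ii) $g_\lambda(x)/x$ is non-increasing on $(0,\infty)$; (iii) $g_\lambda$ is differentiable at every $x\ne0$, $\lim_{x\to0^+}g_\lambda'(x)=\lambda k_0$, and $g_\lambda'(x)\le\lambda k_0$ for all $x>0$; (iv) $g_\lambda(x)+\frac{\mu}{2}x^2$ is convex on $(0,\infty)$. Put $$G_\lambda(\mathcal X)=\sum_{k=1}^{n_3}\sum_{j=1}^{\min\{n_1,n_2\}}g_\lambda\big(\sigma_j(\widehat{\mathcal X}_{\mathbf U}^{\langle k\rangle})\big).$$ **Model.** Let $f:\mathbb R^{n_1\times n_2\times n_3}\to\mathbb R$ be differentiable, $\beta,c,t>0$, and consider $$\min_{\mathcal X}\ f(\mathcal X)+\beta G_\lambda(\mathcal X)\quad\text{s.t.}\quad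 \|\mathcal X\|_\infty\le c .$$ A point $\tilde{\mathcal X}$ is called stationary for minimizing $\varphi$ over a set $S$ if $0\in\partial(\varphi+\delta_S)(\tilde{\mathcal X})$, where $\delta_S$ is $0$ on $S$ and $+\infty$ off $S$ and $\partial$ is the limiting subdifferential: for $F:\mathbb R^N\to(-\infty,+\infty]$ finite at $x$, $\widehat\partial F(x)$ is the set of $y$ with $\liminf_{z\to x,\,z\ne x}\frac{F(z)-F(x)-\langle y,z-x\rangle}{\|z-x\|}\ge0$, and $\partial F(x)$ is the set of limits of sequences $y^k\in\widehat\partial F(x^k)$ with $x^k\to x$ and $F(x^k)\to F(x)$. **Theorem.** Let $\mathcal X^*\in\mathbb R^{n_1\times n_2\times n_3}$ satisfy $\|\mathcal X^*\|_\infty\le c$ and $\|\mathcal X^*\|_{\mathrm{TTNN}}\le t$. Suppose that $f$ satisfies the restricted strong convexity condition with constants $\alpha_1,\alpha_2>0$, $\tau_1,\tau_2\ge0$: for every $\tilde{\mathcal V}\in\mathbb R^{n_1\times n_2\times n_3}$, $$\langle\nabla f(\mathcal X^*+\tilde{\mathcal V})-\nabla f(\mathcal X^*),\tilde{\mathcal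 V}\rangle\ \ge\ \begin{cases}\alpha_1\|\tilde{\mathcal V}\|_F^2-\tau_1\frac{\log d}{n}\|\tilde{\mathcal V}\|_{\mathrm{TTNN}}^2,&\|\tilde{\mathcal V}\|_F\le1,\\[2pt] \alpha_2\|\tilde{\mathcal V}\|_F-\tau_2\sqrt{\frac{\log d}{n}}\,\|\tilde{\mathcal V}\|_{\mathrm{TTNN}},&\|\tilde{\mathcal V}\|_F>1.\end{cases}$$ Assume $\frac34\beta\mu<\alpha_1$, $$\frac{4}{\beta k_0}\max\Big\{\|\nabla f(\mathcal X^*)\|_{\mathbf U},\ \alpha_2\sqrt{\tfrac{\log d}{n}}\Big\}\le\lambda\le\frac{\alpha_2}{6t\beta k_0},\qquad n\ \ge\ \frac{16t^2\max\{\tau_1^2,\tau_2^2\}}{\alpha_2^2}\log d .$$ Then every stationary point $\tilde{\mathcal X}$ of the model with $\|\tilde{\mathcal X}\|_{\mathrm{TTNN}}\le t$, and likewise every stationary point of the model with the additional constraint $\|\mathcal X\|_{\mathrm{TTNN}}\le t$, satisfies $$\|\tilde{\mathcal X}-\mathcal X^*\|_F\ \le\ \frac{6\beta\lambda k_0\sqrt{\sum_{i=1}^{n_3}r_i}}{4\alpha_1-3\beta\mu},\qquad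 r_i=\operatorname{rank}\big((\widehat{\mathcal X^*})_{\mathbf U}^{\langle i\rangle}\big).$$ -/

import Mathlib

open Filter Topology

noncomputable section

namespace LowRankTensor

/-- Real tensors of size `n₁ × n₂ × n₃`. The Euclidean inner product and norm are the tensor
inner product `⟨𝒜, ℬ⟩ = ∑ 𝒜ᵢⱼₖ ℬᵢⱼₖ` and the tensor Frobenius norm. -/
abbrev Tensor (n₁ n₂ n₃ : ℕ) : Type :=
  EuclideanSpace ℝ (Fin n₁ × Fin n₂ × Fin n₃)

/-- `singVal A j` is the `(j+1)`-st largest singular value of `A` (and `0` for large `j`). -/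
def singVal {m n : Type*} [Fintype m] [Fintype n] [DecidableEq n]
    (A : Matrix m n ℂ) (j : ℕ) : ℝ :=
  (Matrix.toEuclideanLin A).singularValues j

section Transform

variable {n₁ n₂ n₃ : ℕ}

/-- The `k`-th frontal slice of the transformed tensor `𝐔[𝒳] = Fold₃(𝐔 𝒳₍₃₎)`. -/
def transformedSlice (U : Matrix (Fin n₃) (Fin n₃) ℂ) (X : Tensor n₁ n₂ n₃) (k : Fin n₃) :
    Matrix (Fin n₁) (Fin n₂) ℂ :=
  Matrix.of fun i j => ∑ l : Fin n₃, U k l * ((X (i, j, l) : ℝ) : ℂ)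

/-- The nuclear norm of a matrix. -/
def nuclearNorm (A : Matrix (Fin n₁) (Fin n₂) ℂ) : ℝ :=
  ∑ j ∈ Finset.range (min n₁ n₂), singVal A j

/-- The transformed tensor nuclear norm. -/
def ttnn (U : Matrix (Fin n₃) (Fin n₃) ℂ) (X : Tensor n₁ n₂ n₃) : ℝ :=
  ∑ k : Fin n₃, nuclearNorm (transformedSlice U X k)

/-- The tensor spectral norm with respect to `𝐔`: the largest singular value of the block
diagonal matrix whose blocks are the frontal slices of `𝐔[𝒳]`. -/
def tensorSpectralNorm (U : Matrix (Fin n₃) (Fin n₃) ℂ) (X : Tensor n₁ n₂ n₃) : ℝ :=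
  singVal (Matrix.blockDiagonal fun k : Fin n₃ => transformedSlice U X k) 0

/-- The sum `r₁ + ⋯ + r_{n₃}` of the entries of the transformed multi-rank. -/
def sumTransformedRank (U : Matrix (Fin n₃) (Fin n₃) ℂ) (X : Tensor n₁ n₂ n₃) : ℕ :=
  ∑ k : Fin n₃, (transformedSlice U X k).rank

/-- The tensor `ℓ_∞` norm. -/
def tensorInfNorm (X : Tensor n₁ n₂ n₃) : ℝ :=
  ⨆ p : Fin n₁ × Fin n₂ × Fin n₃, |X p|

/-- The regularizer `G_λ(𝒳) = ∑ᵢ ∑ⱼ g_λ(σⱼ(i-th transformed frontal slice))`. -/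
def regularizer (U : Matrix (Fin n₃) (Fin n₃) ℂ) (g : ℝ → ℝ) (X : Tensor n₁ n₂ n₃) : ℝ :=
  ∑ k : Fin n₃, ∑ j ∈ Finset.range (min n₁ n₂), g (singVal (transformedSlice U X k) j)

/-- The restricted strong convexity condition at `Xstar`, with `d = n₁ n₂ n₃`. -/
def RestrictedStrongConvexity (U : Matrix (Fin n₃) (Fin n₃) ℂ) (f : Tensor n₁ n₂ n₃ → ℝ)
    (Xstar : Tensor n₁ n₂ n₃) (n : ℕ) (α₁ α₂ τ₁ τ₂ : ℝ) : Prop :=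
  ∀ V : Tensor n₁ n₂ n₃,
    (‖V‖ ≤ 1 →
      α₁ * ‖V‖ ^ 2 - τ₁ * (Real.log ((n₁ * n₂ * n₃ : ℕ) : ℝ) / n) * ttnn U V ^ 2
        ≤ inner ℝ (gradient f (Xstar + V) - gradient f Xstar) V) ∧
    (1 < ‖V‖ →
      α₂ * ‖V‖ - τ₂ * √(Real.log ((n₁ * n₂ * n₃ : ℕ) : ℝ) / n) * ttnn U V
        ≤ inner ℝ (gradient f (Xstar + V) - gradient f Xstar) V)

end Transform

/-- The assumptions on the nonconvex penalty `g = g_λ`, with `lam = λ`. -/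
structure PenaltyAssumption (g : ℝ → ℝ) (lam k₀ μ : ℝ) : Prop where
  nonneg : ∀ x, 0 ≤ g x
  symm : ∀ x, g (-x) = g x
  concave : ConcaveOn ℝ (Set.Ici 0) g
  mono : MonotoneOn g (Set.Ici 0)
  map_zero : g 0 = 0
  continuousAt_zero : ContinuousAt g 0
  div_anti : AntitoneOn (fun x => g x / x) (Set.Ioi 0)
  diff : ∀ x, x ≠ 0 → DifferentiableAt ℝ g x
  k₀_pos : 0 < k₀
  deriv_lim : Tendsto (deriv g) (𝓝[>] 0) (𝓝 (lam * k₀))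
  deriv_le : ∀ x, 0 < x → deriv g x ≤ lam * k₀
  μ_pos : 0 < μ
  weakConvex : ConvexOn ℝ (Set.Ioi 0) (fun x => g x + μ / 2 * x ^ 2)

section Subdifferential

variable {E : Type*} [NormedAddCommGroup E] [InnerProductSpace ℝ E]

/-- The regular subdifferential of `F : E → (-∞, +∞]` at `x`, for `F x` finite. -/
def regularSubdifferential (F : E → EReal) (x : E) : Set E :=
  {y | F x ≠ ⊤ ∧ F x ≠ ⊥ ∧
    0 ≤ liminf (fun z => (F z - F x - ((inner ℝ y (z - x) : ℝ) : EReal)) / ((‖z - x‖ : ℝ) : EReal))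
      (𝓝[≠] x)}

/-- The limiting subdifferential of `F : E → (-∞, +∞]` at `x`, for `F x` finite. -/
def limitingSubdifferential (F : E → EReal) (x : E) : Set E :=
  {y | F x ≠ ⊤ ∧ F x ≠ ⊥ ∧
    ∃ (u : ℕ → E) (v : ℕ → E),
      Tendsto u atTop (𝓝 x) ∧ Tendsto (fun k => F (u k)) atTop (𝓝 (F x)) ∧
      Tendsto v atTop (𝓝 y) ∧ ∀ k, v k ∈ regularSubdifferential F (u k)}

open Classical in
/-- The indicator function of a set: `0` on the set and `+∞` elsewhere. -/
def setIndicator (S : Set E) (x : E) : EReal :=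
  if x ∈ S then 0 else ⊤

/-- `x` is a stationary point of the problem of minimizing `φ` over `S`:
`0 ∈ ∂(φ + δ_S)(x)`. -/
def IsStationaryPoint (φ : E → ℝ) (S : Set E) (x : E) : Prop :=
  (0 : E) ∈ limitingSubdifferential (fun z => ((φ z : ℝ) : EReal) + setIndicator S z) x

end Subdifferential

end LowRankTensor

end

/-! Let u be close to the stationary point and carry a small regular subgradient v of the
constrained objective. Put V = u - X*, L = λk₀, T = ‖V‖_TTNN, and write G for the regularizer. Both
feasible sets are convex and contain X*, so the segment from u to X* is feasible. Hence ⟨v, -V⟩ ≤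
⟨∇f(u), -V⟩ + βM whenever G(u - sV) ≤ G(u) + sM on [0,1]. Two values of M are used. Subadditivity of
G allows M = LT, which together with restricted strong convexity at large scale excludes ‖V‖ > 1.
Weak convexity of G allows M = G(X*) - G(u) + (μ/2)‖V‖², and restricted strong convexity at small
scale then gives α₁‖V‖² ≤ β(G(X*) - G(u)) + (βμ/2)‖V‖² + (βL/2)T + ‖v‖‖V‖, where half of the T term
pays for ⟨∇f(X*), V⟩ (norm duality) and half for the tolerance. By LT ≤ G(V) + (μ/2)‖V‖², T is
traded for G(V)/2, and the total weight of βμ becomes 1/2 + 1/4 = 3/4. Finally G(X*) - G(X* + V) +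
G(V)/2 ≤ (3/2)L√(∑rᵢ)‖V‖; dividing by ‖V‖ and letting v → 0 gives the bound.

Two facts about singular values carry this. For concave nondecreasing g with g(0) = 0, ∑|g(σᵢ(T+B))
- g(σᵢ(T))| ≤ ∑g(σᵢ(B)) (`sum_abs_sub_le_spectralSum`). It reduces to B of rank one, where the
intervals between old and new singular values do not overlap and have total length at most ‖B‖, so
concavity lets them be pushed down to 0. For convex nondecreasing h with h(0) = 0, ∑h(σᵢ(·)) is
convex (`convexOn_spectralSum`), because it dominates the diagonal sums over all pairs of Bessel
systems and equals one of them. -/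

noncomputable section

namespace LowRankTensor

/-! ### Variational principles for eigenvalues and singular values -/

section Spectral

open Module

variable {E : Type*} [NormedAddCommGroup E] [InnerProductSpace ℂ E]

/-- On the span of an orthonormal family of eigenvectors with eigenvalues at least `a`, the
quadratic form of the operator is at least `a`. -/
theorem form_ge_of_mem_span {ι : Type*} [Fintype ι] {w : ι → E} (hw : Orthonormal ℂ w)
    {T : E →ₗ[ℂ] E} {b : ι → ℝ} (hT : ∀ j, T (w j) = (b j : ℂ) • w j) {a : ℝ}
    (hab : ∀ j, a ≤ b j) {x : E} (hx : x ∈ Submodule.span ℂ (Set.range w)) :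
    a * ‖x‖ ^ 2 ≤ (inner ℂ (T x) x).re := by
  obtain ⟨c, rfl⟩ := (Submodule.mem_span_range_iff_exists_fun ℂ).1 hx
  have h1 : T (∑ i, c i • w i) = ∑ i, (c i * b i) • w i := by
    rw [map_sum]
    exact Finset.sum_congr rfl fun i _ => by rw [map_smul, hT, smul_smul]
  have h2 : ‖∑ i, c i • w i‖ ^ 2 = ∑ i, ‖c i‖ ^ 2 := by
    have := hw.inner_sum c c Finset.univ
    rw [← Complex.ofReal_inj]
    rw [inner_self_eq_norm_sq_to_K] at this
    simp only [Complex.ofReal_pow, Complex.ofReal_sum]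
    refine this.trans (Finset.sum_congr rfl fun i _ => ?_)
    rw [← Complex.normSq_eq_conj_mul_self, Complex.normSq_eq_norm_sq]
    simp
  have h3 : (inner ℂ (T (∑ i, c i • w i)) (∑ i, c i • w i)).re = ∑ i, b i * ‖c i‖ ^ 2 := by
    rw [h1, hw.inner_sum, Complex.re_sum]
    refine Finset.sum_congr rfl fun i _ => ?_
    rw [map_mul, Complex.conj_ofReal, mul_right_comm, ← Complex.normSq_eq_conj_mul_self,
      Complex.normSq_eq_norm_sq, ← Complex.ofReal_mul, Complex.ofReal_re, mul_comm]
  rw [h2, h3, Finset.mul_sum]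
  exact Finset.sum_le_sum fun i _ => mul_le_mul_of_nonneg_right (hab i) (by positivity)

variable [FiniteDimensional ℂ E]

theorem exists_ne_zero_mem_inf (S W : Submodule ℂ E)
    (h : finrank ℂ E < finrank ℂ S + finrank ℂ W) : ∃ x ≠ 0, x ∈ S ∧ x ∈ W := by
  have h1 := Submodule.finrank_sup_add_finrank_inf_eq S W
  have h2 := Submodule.finrank_le (S ⊔ W)
  have h3 : 0 < finrank ℂ (S ⊓ W : Submodule ℂ E) := by omega
  obtain ⟨⟨x, hx⟩, hne⟩ := (finrank_pos_iff_exists_ne_zero).1 h3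
  exact ⟨x, fun h => hne (Subtype.ext h), hx.1, hx.2⟩

/-- One half of the Courant-Fischer principle. -/
theorem le_eigenvalues_of_form_ge {T : E →ₗ[ℂ] E} (hT : T.IsSymmetric) {n : ℕ}
    (hn : finrank ℂ E = n) (i : Fin n) (S : Submodule ℂ E) (hS : i.val < finrank ℂ S) {a : ℝ}
    (h : ∀ x ∈ S, a * ‖x‖ ^ 2 ≤ (inner ℂ (T x) x).re) : a ≤ hT.eigenvalues hn i := by
  set e := hT.eigenvectorBasis hn
  let w : {j : Fin n // i ≤ j} → E := fun j => e j
  have hw : Orthonormal ℂ w := e.orthonormal.comp _ Subtype.val_injective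
  have hdim : finrank ℂ (Submodule.span ℂ (Set.range w)) = n - i := by
    rw [finrank_span_eq_card hw.linearIndependent, Fintype.card_subtype]
    rw [show ({x : Fin n | i ≤ x} : Finset (Fin n)) = Finset.Ici i by ext; simp]
    simp
  -- Dimensions at least i + 1 and exactly n - i force a common nonzero vector; on the second space
  -- the form is at most the i-th eigenvalue.
  obtain ⟨x, hx0, hxS, hxW⟩ := exists_ne_zero_mem_inf S (Submodule.span ℂ (Set.range w))
    (by rw [hdim, hn]; omega)
  have h1 := h x hxS
  have h2 := form_ge_of_mem_span hw (T := -T) (b := fun j => - hT.eigenvalues hn j)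
    (a := - hT.eigenvalues hn i) (fun j => by
      have := hT.apply_eigenvectorBasis hn j
      simp only [LinearMap.neg_apply, w, e, Complex.ofReal_neg, neg_smul, this]
      rfl)
    (fun j => neg_le_neg (hT.eigenvalues_antitone hn j.2)) hxW
  simp only [LinearMap.neg_apply, inner_neg_left, Complex.neg_re] at h2
  have h3 : a * ‖x‖ ^ 2 ≤ hT.eigenvalues hn i * ‖x‖ ^ 2 := by linarith
  exact le_of_mul_le_mul_right h3 (by positivity)

theorem le_eigenvalues_of_orthonormal {T : E →ₗ[ℂ] E} (hT : T.IsSymmetric) {n : ℕ}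
    (hn : finrank ℂ E = n) (i : Fin n) {ι : Type*} [Fintype ι] {w : ι → E}
    (hw : Orthonormal ℂ w) {b : ι → ℝ} (hTw : ∀ j, T (w j) = (b j : ℂ) • w j) {a : ℝ}
    (hab : ∀ j, a ≤ b j) (hcard : i.val < Fintype.card ι) : a ≤ hT.eigenvalues hn i :=
  le_eigenvalues_of_form_ge hT hn i _
    (by rwa [finrank_span_eq_card hw.linearIndependent])
    fun _ hx => form_ge_of_mem_span hw hTw hab hx

/-- The span of the eigenvectors belonging to the `i + 1` largest eigenvalues. -/
theorem exists_submodule_form_ge {T : E →ₗ[ℂ] E} (hT : T.IsSymmetric) {n : ℕ}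
    (hn : finrank ℂ E = n) (i : Fin n) : ∃ S : Submodule ℂ E, finrank ℂ S = i.val + 1 ∧
      ∀ x ∈ S, hT.eigenvalues hn i * ‖x‖ ^ 2 ≤ (inner ℂ (T x) x).re := by
  set e := hT.eigenvectorBasis hn
  let w : {j : Fin n // j ≤ i} → E := fun j => e j
  have hw : Orthonormal ℂ w := e.orthonormal.comp _ Subtype.val_injective
  refine ⟨Submodule.span ℂ (Set.range w), ?_, fun x hx => form_ge_of_mem_span hw
    (b := fun j => hT.eigenvalues hn j) (fun j => hT.apply_eigenvectorBasis hn j)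
    (fun j => hT.eigenvalues_antitone hn j.2) hx⟩
  rw [finrank_span_eq_card hw.linearIndependent, Fintype.card_subtype]
  rw [show ({x : Fin n | x ≤ i} : Finset (Fin n)) = Finset.Iic i by ext; simp]
  simp

theorem eigenvalues_le_of_orthonormal {T : E →ₗ[ℂ] E} (hT : T.IsSymmetric) {n : ℕ}
    (hn : finrank ℂ E = n) (i : Fin n) {ι : Type*} [Fintype ι] {w : ι → E}
    (hw : Orthonormal ℂ w) {b : ι → ℝ} (hTw : ∀ j, T (w j) = (b j : ℂ) • w j) {a : ℝ}
    (hab : ∀ j, b j ≤ a) (hcard : n ≤ i.val + Fintype.card ι) : hT.eigenvalues hn i ≤ a := by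
  obtain ⟨S, hS, hform⟩ := exists_submodule_form_ge hT hn i
  obtain ⟨x, hx0, hxS, hxW⟩ := exists_ne_zero_mem_inf S (Submodule.span ℂ (Set.range w))
    (by rw [finrank_span_eq_card hw.linearIndependent]; omega)
  have h1 := hform x hxS
  have h2 := form_ge_of_mem_span hw (T := -T) (b := fun j => - b j) (a := -a)
    (fun j => by simp [hTw]) (fun j => neg_le_neg (hab j)) hxW
  simp only [LinearMap.neg_apply, inner_neg_left, Complex.neg_re] at h2
  have h3 : hT.eigenvalues hn i * ‖x‖ ^ 2 ≤ a * ‖x‖ ^ 2 := by linarith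
  exact le_of_mul_le_mul_right h3 (by positivity)

/-- Weyl's inequality for forms that are ordered on a subspace of codimension at most `k`. -/
theorem eigenvalues_le_of_form_le {H K : E →ₗ[ℂ] E} (hH : H.IsSymmetric) (hK : K.IsSymmetric)
    {n : ℕ} (hn : finrank ℂ E = n) (S : Submodule ℂ E) {k : ℕ} (hS : n ≤ finrank ℂ S + k)
    (h : ∀ x ∈ S, (inner ℂ (H x) x).re ≤ (inner ℂ (K x) x).re) {i j : Fin n}
    (hij : j.val + k ≤ i.val) : hH.eigenvalues hn i ≤ hK.eigenvalues hn j := by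
  obtain ⟨W, hW, hform⟩ := exists_submodule_form_ge hH hn i
  refine le_eigenvalues_of_form_ge hK hn j (W ⊓ S) ?_ fun x hx =>
    (hform x hx.1).trans (h x hx.2)
  have h1 := Submodule.finrank_sup_add_finrank_inf_eq W S
  have h2 := Submodule.finrank_le (W ⊔ S)
  omega

variable {F : Type*} [NormedAddCommGroup F] [InnerProductSpace ℂ F] [FiniteDimensional ℂ F]

/-- Courant-Fischer applied to T†T, whose quadratic form is ‖Tx‖² and whose eigenvalues are the
squared singular values. -/
theorem le_singularValues {T : E →ₗ[ℂ] F} {i : ℕ} (S : Submodule ℂ E) (hS : i < finrank ℂ S)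
    {a : ℝ} (h : ∀ x ∈ S, a * ‖x‖ ≤ ‖T x‖) : a ≤ T.singularValues i := by
  by_cases ha : a < 0
  · exact ha.le.trans (T.singularValues_nonneg i)
  push Not at ha
  have hi : i < finrank ℂ E := hS.trans_le (Submodule.finrank_le S)
  have h1 := le_eigenvalues_of_form_ge T.isSymmetric_adjoint_comp_self rfl ⟨i, hi⟩ S hS
    (a := a ^ 2) (fun x hx => by
      rw [LinearMap.comp_apply, LinearMap.adjoint_inner_left]
      have := inner_self_eq_norm_sq (𝕜 := ℂ) (T x)
      simp only [RCLike.re_eq_complex_re] at this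
      rw [this, ← mul_pow]
      exact pow_le_pow_left₀ (by positivity) (h x hx) 2)
  rw [← T.sq_singularValues_of_lt rfl hi] at h1
  exact le_of_sq_le_sq h1 (T.singularValues_nonneg i)

/-- Singular value decomposition: `e` is an orthonormal basis of right singular vectors, and the
left singular vectors `u i` are orthonormal, except that they vanish for zero singular values. -/
theorem exists_svd (T : E →ₗ[ℂ] F) {n : ℕ} (hn : finrank ℂ E = n) :
    ∃ (e : OrthonormalBasis (Fin n) ℂ E) (u : Fin n → F),
      (∀ i, T (e i) = (T.singularValues i : ℂ) • u i) ∧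
      (∀ i, LinearMap.adjoint T (u i) = (T.singularValues i : ℂ) • e i) ∧
      (∀ i j, i ≠ j → inner ℂ (u i) (u j) = 0) ∧
      (∀ i : Fin n, T.singularValues i ≠ 0 → ‖u i‖ = 1) ∧
      (∀ i : Fin n, T.singularValues i = 0 → u i = 0) := by
  have hT := T.isSymmetric_adjoint_comp_self
  set e := hT.eigenvectorBasis hn
  have hTT : ∀ i, LinearMap.adjoint T (T (e i)) = ((T.singularValues i : ℂ) ^ 2) • e i := by
    intro i
    have := hT.apply_eigenvectorBasis hn i
    rw [LinearMap.comp_apply] at this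
    rw [this, ← T.sq_singularValues_fin hn, RCLike.ofReal_pow]
    rfl
  have hin : ∀ i j, inner ℂ (T (e i)) (T (e j)) =
      ((T.singularValues i : ℂ) ^ 2) * if i = j then 1 else 0 := by
    intro i j
    rw [← LinearMap.adjoint_inner_left, hTT, inner_smul_left,
      orthonormal_iff_ite.1 e.orthonormal i j]
    simp
  have hnorm : ∀ i, ‖T (e i)‖ = T.singularValues i := by
    intro i
    have h1 := hin i i
    rw [inner_self_eq_norm_sq_to_K] at h1
    simp only [if_true, mul_one] at h1
    have h2 : ‖T (e i)‖ ^ 2 = T.singularValues i ^ 2 :=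
      Complex.ofReal_injective (by push_cast; exact h1)
    exact (pow_left_inj₀ (norm_nonneg _) (T.singularValues_nonneg i) two_ne_zero).1 h2
  -- With 0⁻¹ = 0 this single formula makes the left vector vanish exactly when the singular value
  -- does.
  refine ⟨e, fun i => ((T.singularValues i : ℂ)⁻¹) • T (e i), ?_, ?_, ?_, ?_, ?_⟩
  · intro i
    by_cases h : T.singularValues i = 0
    · rw [h]
      have := hnorm i
      rw [h, norm_eq_zero] at this
      simp [this]
    · rw [smul_smul, mul_inv_cancel₀ (by exact_mod_cast h), one_smul]
  · intro i
    rw [map_smul, hTT, smul_smul]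
    by_cases h : T.singularValues i = 0
    · simp [h]
    · congr 1
      have : (T.singularValues i : ℂ) ≠ 0 := by exact_mod_cast h
      field_simp
  · intro i j hij
    rw [inner_smul_left, inner_smul_right, hin, if_neg hij]
    simp
  · intro i h
    rw [norm_smul, hnorm, norm_inv, Complex.norm_real, Real.norm_of_nonneg
      (T.singularValues_nonneg i), inv_mul_cancel₀ h]
  · intro i h
    simp [h]

end Spectral

/-! ### Hermitian dilation and rank one perturbations -/

section Dilation

open Module InnerProductSpace

variable {E F : Type*} [NormedAddCommGroup E] [InnerProductSpace ℂ E] [FiniteDimensional ℂ E]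
  [NormedAddCommGroup F] [InnerProductSpace ℂ F] [FiniteDimensional ℂ F]

/-- The Hermitian dilation `(x, y) ↦ (T† y, T x)` of `T`. -/
def dilation (T : E →ₗ[ℂ] F) : WithLp 2 (E × F) →ₗ[ℂ] WithLp 2 (E × F) where
  toFun z := WithLp.toLp 2 (LinearMap.adjoint T z.snd, T z.fst)
  map_add' x y := by simp [← WithLp.toLp_add]
  map_smul' c x := by simp [← WithLp.toLp_smul]

theorem dilation_apply (T : E →ₗ[ℂ] F) (z : WithLp 2 (E × F)) :
    dilation T z = WithLp.toLp 2 (LinearMap.adjoint T z.snd, T z.fst) := rfl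

theorem dilation_isSymmetric (T : E →ₗ[ℂ] F) : (dilation T).IsSymmetric := by
  intro x y
  simp only [dilation_apply, WithLp.prod_inner_apply]
  rw [LinearMap.adjoint_inner_left, ← LinearMap.adjoint_inner_right, add_comm]
  rfl

theorem re_inner_dilation (T : E →ₗ[ℂ] F) (z : WithLp 2 (E × F)) :
    (inner ℂ (dilation T z) z).re = 2 * (inner ℂ (T z.fst) z.snd).re := by
  simp only [dilation_apply, WithLp.prod_inner_apply]
  rw [LinearMap.adjoint_inner_left, Complex.add_re, ← inner_conj_symm, Complex.conj_re]
  simp only [WithLp.ofLp_fst, WithLp.ofLp_snd]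
  ring

theorem finrank_withLp_prod : finrank ℂ (WithLp 2 (E × F)) = finrank ℂ E + finrank ℂ F := by
  rw [(WithLp.linearEquiv 2 ℂ (E × F)).finrank_eq, finrank_prod]

/-- The eigenvalues of the dilation are symmetric about `0`. -/
theorem eigenvalues_dilation_rev (T : E →ₗ[ℂ] F) {N : ℕ}
    (hN : finrank ℂ (WithLp 2 (E × F)) = N) (i : Fin N) :
    (dilation_isSymmetric T).eigenvalues hN i.rev = -(dilation_isSymmetric T).eigenvalues hN i := by
  set hT := dilation_isSymmetric T
  set e := hT.eigenvectorBasis hN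
  -- This isometry anticommutes with the dilation, so it sends eigenvectors for an eigenvalue to
  -- eigenvectors for its negative.
  let J : WithLp 2 (E × F) → WithLp 2 (E × F) := fun z => WithLp.toLp 2 (z.fst, -z.snd)
  have hJ : ∀ x y, inner ℂ (J x) (J y) = inner ℂ x y := by
    intro x y
    simp [J, WithLp.prod_inner_apply]
  have hw : Orthonormal ℂ fun j => J (e j) := by
    rw [orthonormal_iff_ite]
    intro a b
    simp only [hJ, orthonormal_iff_ite.1 e.orthonormal]
  have hTw : ∀ j, dilation T (J (e j)) = ((- hT.eigenvalues hN j : ℝ) : ℂ) • J (e j) := by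
    intro j
    have h1 : dilation T (J (e j)) = - J (dilation T (e j)) := by
      simp [J, dilation_apply, ← WithLp.toLp_neg]
    have h2 : dilation T (e j) = (hT.eigenvalues hN j : ℂ) • e j := hT.apply_eigenvectorBasis hN j
    have h3 : ∀ (c : ℂ) z, J (c • z) = c • J z := by
      intro c z
      simp [J, ← WithLp.toLp_smul]
    rw [h1, h2, h3]
    simp
  apply le_antisymm
  · have hw' : Orthonormal ℂ fun j : {j : Fin N // j ≤ i} => J (e j) :=
      hw.comp _ Subtype.val_injective
    refine eigenvalues_le_of_orthonormal hT hN i.rev hw' (b := fun j => - hT.eigenvalues hN j)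
      (fun j => hTw j) (fun j => neg_le_neg (hT.eigenvalues_antitone hN j.2)) ?_
    rw [Fintype.card_subtype,
      show ({x : Fin N | x ≤ i} : Finset (Fin N)) = Finset.Iic i by ext; simp]
    simp [Fin.val_rev]
  · have hw' : Orthonormal ℂ fun j : {j : Fin N // i ≤ j} => J (e j) :=
      hw.comp _ Subtype.val_injective
    refine le_eigenvalues_of_orthonormal hT hN i.rev hw' (b := fun j => - hT.eigenvalues hN j)
      (fun j => hTw j) (fun j => neg_le_neg (hT.eigenvalues_antitone hN j.2)) ?_
    rw [Fintype.card_subtype,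
      show ({x : Fin N | i ≤ x} : Finset (Fin N)) = Finset.Ici i by ext; simp]
    simp [Fin.val_rev]
    omega

/-- If the eigenvalue a is positive, the form is at least a‖z‖² on a space of dimension i + 1. There
a(‖x‖² + ‖y‖²) ≤ 2‖Tx‖‖y‖, so x = 0 forces y = 0 and the projection to E keeps the dimension; since
2‖x‖‖y‖ ≤ ‖x‖² + ‖y‖², also a‖x‖ ≤ ‖Tx‖. -/
theorem eigenvalues_dilation_le (T : E →ₗ[ℂ] F) {N : ℕ}
    (hN : finrank ℂ (WithLp 2 (E × F)) = N) (i : Fin N) :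
    (dilation_isSymmetric T).eigenvalues hN i ≤ T.singularValues i := by
  set a := (dilation_isSymmetric T).eigenvalues hN i with ha
  by_cases h0 : a ≤ 0
  · exact h0.trans (T.singularValues_nonneg i)
  push Not at h0
  obtain ⟨S, hS, hform⟩ := exists_submodule_form_ge (dilation_isSymmetric T) hN i
  rw [← ha] at hform
  have hform' : ∀ z ∈ S, a * (‖z.fst‖ ^ 2 + ‖z.snd‖ ^ 2) ≤ 2 * (‖T z.fst‖ * ‖z.snd‖) := by
    intro z hz
    have h1 := hform z hz
    rw [re_inner_dilation, WithLp.prod_norm_sq_eq_of_L2] at h1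
    have h2 := (Complex.re_le_norm _).trans (norm_inner_le_norm (𝕜 := ℂ) (T z.fst) z.snd)
    linarith
  let p : WithLp 2 (E × F) →ₗ[ℂ] E :=
    LinearMap.fst ℂ E F ∘ₗ (WithLp.linearEquiv 2 ℂ (E × F)).toLinearMap
  have hp : ∀ z, p z = z.fst := fun _ => rfl
  refine le_singularValues (S.map p) ?_ ?_
  · have hinj : Function.Injective (p.domRestrict S) := by
      rw [injective_iff_map_eq_zero]
      rintro ⟨z, hz⟩ h
      have hz1 : z.fst = 0 := h
      have h1 := hform' z hz
      rw [hz1] at h1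
      simp only [norm_zero, map_zero, zero_mul, mul_zero] at h1
      have h2 : ‖z.snd‖ = 0 := by
        have : a * ‖z.snd‖ ^ 2 ≤ 0 := by linarith
        by_contra hne
        have : 0 < ‖z.snd‖ := lt_of_le_of_ne (norm_nonneg _) (Ne.symm hne)
        have : 0 < a * ‖z.snd‖ ^ 2 := by positivity
        linarith
      have h3 : ‖z‖ ^ 2 = 0 := by rw [WithLp.prod_norm_sq_eq_of_L2, hz1, h2]; simp
      apply Subtype.ext
      simpa using h3
    have h1 : S.map p = LinearMap.range (p.domRestrict S) := by
      rw [LinearMap.range_domRestrict]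
    rw [h1, LinearMap.finrank_range_of_inj hinj, hS]
    omega
  · rintro _ ⟨z, hz, rfl⟩
    rw [hp]
    have h1 := hform' z hz
    by_cases hy : ‖z.snd‖ = 0
    · rw [hy] at h1
      have h2 : a * ‖z.fst‖ ^ 2 ≤ 0 := by simpa using h1
      have h3 : ‖z.fst‖ = 0 := by
        by_contra hne
        have : 0 < ‖z.fst‖ := lt_of_le_of_ne (norm_nonneg _) (Ne.symm hne)
        have : 0 < a * ‖z.fst‖ ^ 2 := by positivity
        linarith
      rw [h3]
      simp
    · have hy' : 0 < ‖z.snd‖ := lt_of_le_of_ne (norm_nonneg _) (Ne.symm hy)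
      refine le_of_mul_le_mul_right (a := ‖z.snd‖) ?_ hy'
      nlinarith [mul_nonneg h0.le (sq_nonneg (‖z.fst‖ - ‖z.snd‖))]

theorem eigenvalues_dilation_eq (T : E →ₗ[ℂ] F) {N : ℕ}
    (hN : finrank ℂ (WithLp 2 (E × F)) = N) (i : Fin N) (hi : i.val < finrank ℂ E) :
    (dilation_isSymmetric T).eigenvalues hN i = T.singularValues i := by
  refine le_antisymm (eigenvalues_dilation_le T hN i) ?_
  by_cases h0 : T.singularValues i = 0
  · rw [h0]
    -- The form of the dilation vanishes on E × 0, whose dimension exceeds i, so the i-th eigenvalue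
    -- is nonnegative.
    let q : E →ₗ[ℂ] WithLp 2 (E × F) :=
      (WithLp.linearEquiv 2 ℂ (E × F)).symm.toLinearMap ∘ₗ LinearMap.inl ℂ E F
    have hq : Function.Injective q :=
      (WithLp.linearEquiv 2 ℂ (E × F)).symm.injective.comp LinearMap.inl_injective
    refine le_eigenvalues_of_form_ge _ hN i (LinearMap.range q) ?_ ?_
    · rwa [LinearMap.finrank_range_of_inj hq]
    · rintro _ ⟨x, rfl⟩
      rw [re_inner_dilation]
      have : (q x).snd = 0 := rfl
      simp [this]
  · obtain ⟨e, u, hTe, hTu, huo, hu1, -⟩ := exists_svd T (n := finrank ℂ E) rfl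
    have hpos : ∀ j : ℕ, j ≤ i → T.singularValues j ≠ 0 := by
      intro j hj
      have := T.singularValues_antitone hj
      have h2 : 0 < T.singularValues i :=
        lt_of_le_of_ne (T.singularValues_nonneg i) (Ne.symm h0)
      linarith
    let r : ℂ := ((√2)⁻¹ : ℝ)
    have hr : r * r = 1 / 2 := by
      simp only [r]
      rw [← Complex.ofReal_mul, ← mul_inv, Real.mul_self_sqrt (by norm_num)]
      norm_num
    have hrr : (starRingEnd ℂ) r = r := Complex.conj_ofReal _
    -- A pair of right and left singular vectors, divided by √2, is a unit eigenvector of the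
    -- dilation with eigenvalue the singular value.
    let w : {j : Fin (finrank ℂ E) // j.val ≤ i.val} → WithLp 2 (E × F) :=
      fun j => r • WithLp.toLp 2 (e j, u j)
    have hw : Orthonormal ℂ w := by
      rw [orthonormal_iff_ite]
      intro a b
      simp only [w, inner_smul_left, inner_smul_right, WithLp.prod_inner_apply,
        orthonormal_iff_ite.1 e.orthonormal, hrr]
      by_cases hab : a = b
      · subst hab
        simp only [if_true]
        rw [inner_self_eq_norm_sq_to_K, hu1 a (hpos _ a.2), ← mul_assoc, hr]
        norm_num
      · have : a.1 ≠ b.1 := fun h => hab (Subtype.ext h)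
        rw [if_neg this, if_neg hab, huo _ _ this]
        simp
    refine le_eigenvalues_of_orthonormal _ hN i hw (b := fun j => T.singularValues j) ?_
      (fun j => T.singularValues_antitone j.2) ?_
    · intro j
      change dilation T (r • _) = _ • (r • _)
      rw [map_smul, smul_comm, dilation_apply]
      congr 1
      simp [hTe, hTu, ← WithLp.toLp_smul]
    · rw [Fintype.card_subtype]
      have : ({x : Fin (finrank ℂ E) | x.val ≤ i.val} : Finset _) = Finset.Iic ⟨i.val, hi⟩ := by
        ext
        simp [Fin.le_def]
      rw [this]
      simp

/-- Changing `T` by a rank one map changes the dilation by a difference of two positive rank one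
forms. -/
theorem re_inner_dilation_add_rankOne (T : E →ₗ[ℂ] F) (b : ℝ) (u : F) (v : E)
    (z : WithLp 2 (E × F)) :
    (inner ℂ (dilation (T + (b : ℂ) • (rankOne ℂ u v : E →ₗ[ℂ] F)) z) z).re
        + b / 2 * ‖(inner ℂ (WithLp.toLp 2 (v, -u)) z : ℂ)‖ ^ 2
      = (inner ℂ (dilation T z) z).re + b / 2 * ‖(inner ℂ (WithLp.toLp 2 (v, u)) z : ℂ)‖ ^ 2 := by
  rw [re_inner_dilation, re_inner_dilation]
  simp only [WithLp.prod_inner_apply, LinearMap.add_apply, LinearMap.smul_apply,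
    ContinuousLinearMap.coe_coe, rankOne_apply, inner_add_left, inner_smul_left, inner_neg_left,
    Complex.conj_ofReal, Complex.add_re, Complex.re_ofReal_mul, WithLp.ofLp_fst, WithLp.ofLp_snd]
  generalize (inner ℂ v z.fst : ℂ) = α
  generalize (inner ℂ u z.snd : ℂ) = γ
  simp only [← Complex.normSq_eq_norm_sq, Complex.normSq_apply, Complex.mul_re, Complex.conj_re,
    Complex.conj_im, Complex.add_re, Complex.add_im, Complex.neg_re, Complex.neg_im]
  ring

variable (T : E →ₗ[ℂ] F) {b : ℝ} (u : F) (v : E)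

/-- Weyl's inequalities for the dilation under rank one changes: the intermediate eigenvalues
belong to the dilation of `T` plus a positive rank one operator. -/
theorem exists_intermediate_eigenvalues (hb : 0 ≤ b) (hu : ‖u‖ ≤ 1) (hv : ‖v‖ ≤ 1) {N : ℕ}
    (hN : finrank ℂ (WithLp 2 (E × F)) = N) : ∃ κ : Fin N → ℝ,
      (∀ i, (dilation_isSymmetric T).eigenvalues hN i ≤ κ i) ∧
      (∀ i, (dilation_isSymmetric
        (T + (b : ℂ) • (rankOne ℂ u v : E →ₗ[ℂ] F))).eigenvalues hN i ≤ κ i) ∧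
      (∀ i j : Fin N, j.val + 1 ≤ i.val → κ i ≤ (dilation_isSymmetric T).eigenvalues hN j) ∧
      ∑ i, κ i ≤ b := by
  set a : WithLp 2 (E × F) := WithLp.toLp 2 (v, u) with ha
  set P : WithLp 2 (E × F) →ₗ[ℂ] WithLp 2 (E × F) := (rankOne ℂ a a).toLinearMap with hP
  have hPs : P.IsSymmetric := isSymmetric_rankOne_self a
  have hcs : (((b / 2 : ℝ) : ℂ) • P).IsSymmetric :=
    hPs.smul (Complex.conj_ofReal _)
  have hK := (dilation_isSymmetric T).add hcs
  have hform : ∀ z, (inner ℂ ((dilation T + ((b / 2 : ℝ) : ℂ) • P) z) z).re =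
      (inner ℂ (dilation T z) z).re + b / 2 * ‖(inner ℂ a z : ℂ)‖ ^ 2 := by
    intro z
    rw [LinearMap.add_apply, inner_add_left, Complex.add_re, LinearMap.smul_apply, inner_smul_left,
      Complex.conj_ofReal, Complex.re_ofReal_mul]
    simp only [hP, ContinuousLinearMap.coe_coe, rankOne_apply, inner_smul_left]
    rw [← Complex.normSq_eq_conj_mul_self, Complex.normSq_eq_norm_sq, Complex.ofReal_re]
  refine ⟨hK.eigenvalues hN, ?_, ?_, ?_, ?_⟩
  · intro i
    refine eigenvalues_le_of_form_le _ _ hN ⊤ (k := 0) (by simp [hN]) (fun x _ => ?_) le_rfl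
    rw [hform]
    have : 0 ≤ b / 2 * ‖(inner ℂ a x : ℂ)‖ ^ 2 := by positivity
    linarith
  · intro i
    refine eigenvalues_le_of_form_le _ _ hN ⊤ (k := 0) (by simp [hN]) (fun x _ => ?_) le_rfl
    rw [hform, ha, ← re_inner_dilation_add_rankOne]
    have : 0 ≤ b / 2 * ‖(inner ℂ (WithLp.toLp 2 (v, -u)) x : ℂ)‖ ^ 2 := by positivity
    linarith
  -- The added rank one form vanishes on the orthogonal complement of a, which has codimension at
  -- most one: hence the index shift by one.
  · intro i j hij
    refine eigenvalues_le_of_form_le _ _ hN (LinearMap.ker (innerSL ℂ a).toLinearMap) (k := 1)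
      ?_ (fun x hx => ?_) hij
    · have h1 := LinearMap.finrank_range_add_finrank_ker (innerSL ℂ a).toLinearMap
      have h2 := Submodule.finrank_le (LinearMap.range (innerSL ℂ a).toLinearMap)
      rw [finrank_self] at h2
      omega
    · have hx' : inner ℂ a x = 0 := hx
      rw [hform, hx']
      simp
  · rw [← hK.re_trace_eq_sum_eigenvalues hN, map_add, map_smul, map_add, hP,
      trace_rankOne, (dilation_isSymmetric T).re_trace_eq_sum_eigenvalues hN]
    have h0 : ∑ i, (dilation_isSymmetric T).eigenvalues hN i = 0 := by
      have h1 := Equiv.sum_comp Fin.revPerm ((dilation_isSymmetric T).eigenvalues hN)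
      simp only [Fin.revPerm_apply, eigenvalues_dilation_rev, Finset.sum_neg_distrib] at h1
      linarith
    rw [h0, inner_self_eq_norm_sq_to_K, smul_eq_mul, zero_add]
    have h2 : ‖a‖ ^ 2 ≤ 2 := by
      rw [WithLp.prod_norm_sq_eq_of_L2]
      change ‖v‖ ^ 2 + ‖u‖ ^ 2 ≤ 2
      nlinarith [norm_nonneg u, norm_nonneg v]
    have h3 : RCLike.re (((b / 2 : ℝ) : ℂ) * ((‖a‖ : ℝ) : ℂ) ^ 2) = b / 2 * ‖a‖ ^ 2 := by
      rw [← Complex.ofReal_pow, ← Complex.ofReal_mul]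
      exact Complex.ofReal_re _
    refine h3.trans_le ?_
    nlinarith

/-- Mirsky's inequality for a rank one perturbation. -/
theorem sum_abs_singularValues_sub_le (hb : 0 ≤ b) (hu : ‖u‖ ≤ 1) (hv : ‖v‖ ≤ 1) {p : ℕ}
    (hpE : p ≤ finrank ℂ E) (hpF : p ≤ finrank ℂ F) :
    ∑ i ∈ Finset.range p, |(T + (b : ℂ) • (rankOne ℂ u v : E →ₗ[ℂ] F)).singularValues i
      - T.singularValues i| ≤ b := by
  set T' := T + (b : ℂ) • (rankOne ℂ u v : E →ₗ[ℂ] F) with hT'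
  obtain ⟨N, hN⟩ : ∃ N, finrank ℂ (WithLp 2 (E × F)) = N := ⟨_, rfl⟩
  have hN' : 2 * p ≤ N := by rw [← hN, finrank_withLp_prod]; omega
  obtain ⟨κ, h1, h2, -, h4⟩ := exists_intermediate_eigenvalues T u v hb hu hv hN
  rw [← hT'] at h2
  set l := (dilation_isSymmetric T).eigenvalues hN with hl
  set l' := (dilation_isSymmetric T').eigenvalues hN with hl'
  have hrev : ∀ i, l i.rev = - l i := eigenvalues_dilation_rev T hN
  have hrev' : ∀ i, l' i.rev = - l' i := eigenvalues_dilation_rev T' hN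
  have hsum0 : ∀ m : Fin N → ℝ, (∀ i, m i.rev = - m i) → ∑ i, m i = 0 := by
    intro m hm
    have h1 := Equiv.sum_comp Fin.revPerm m
    simp only [Fin.revPerm_apply, hm, Finset.sum_neg_distrib] at h1
    linarith
  -- κ dominates both spectra, so each difference is at most the sum of the two gaps; both dilations
  -- have trace zero, leaving only 2∑κ.
  have hall : ∑ i, |l' i - l i| ≤ 2 * b := by
    calc ∑ i, |l' i - l i| ≤ ∑ i, ((κ i - l' i) + (κ i - l i)) := by
          refine Finset.sum_le_sum fun i _ => ?_
          rw [abs_le]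
          constructor <;> linarith [h1 i, h2 i]
      _ = 2 * ∑ i, κ i := by
          rw [Finset.sum_add_distrib, Finset.sum_sub_distrib, Finset.sum_sub_distrib,
            hsum0 l hrev, hsum0 l' hrev']
          ring
      _ ≤ 2 * b := by linarith
  have hA : ∑ i : Fin N, (if i.val < p then |l' i - l i| else 0) =
      ∑ i ∈ Finset.range p, |T'.singularValues i - T.singularValues i| := by
    have hs : ∀ i : Fin N, (if i.val < p then |l' i - l i| else 0) =
        if i.val < p then |T'.singularValues i - T.singularValues i| else 0 := by
      intro i
      split_ifs with hi
      · rw [hl, hl', eigenvalues_dilation_eq T hN i (by omega),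
          eigenvalues_dilation_eq T' hN i (by omega)]
      · rfl
    simp_rw [hs]
    rw [Fin.sum_univ_eq_sum_range
      (fun i => if i < p then |T'.singularValues i - T.singularValues i| else 0) N,
      ← Finset.sum_filter]
    congr 1
    ext i
    simp
    omega
  have hB : ∑ i : Fin N, (if i.rev.val < p then |l' i - l i| else 0) =
      ∑ i : Fin N, (if i.val < p then |l' i - l i| else 0) := by
    rw [← Equiv.sum_comp Fin.revPerm]
    refine Finset.sum_congr rfl fun i _ => ?_
    simp only [Fin.revPerm_apply, Fin.rev_rev, hrev, hrev', neg_sub_neg, abs_sub_comm (l i)]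
  -- Since 2p ≤ N, the p largest and the p smallest eigenvalues occupy disjoint indices. Each
  -- singular value difference is thus counted twice, which cancels the factor 2 in `hall`.
  have hC : ∑ i : Fin N, (if i.val < p then |l' i - l i| else 0) +
      ∑ i : Fin N, (if i.rev.val < p then |l' i - l i| else 0) ≤ ∑ i, |l' i - l i| := by
    rw [← Finset.sum_add_distrib]
    refine Finset.sum_le_sum fun i _ => ?_
    have := abs_nonneg (l' i - l i)
    have h5 : i.rev.val = N - (i.val + 1) := Fin.val_rev i
    split_ifs with h6 h7
    · omega
    · linarith
    · linarith
    · linarith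
  rw [hB, hA] at hC
  linarith

/-- Interlacing of singular values under a rank one perturbation. -/
theorem singularValues_add_rankOne_succ_le (hb : 0 ≤ b) (hu : ‖u‖ ≤ 1) (hv : ‖v‖ ≤ 1) (i : ℕ) :
    (T + (b : ℂ) • (rankOne ℂ u v : E →ₗ[ℂ] F)).singularValues (i + 1) ≤ T.singularValues i := by
  by_cases hi : i + 1 < finrank ℂ E
  · have hN := finrank_withLp_prod (E := E) (F := F)
    obtain ⟨κ, -, h2, h3, -⟩ := exists_intermediate_eigenvalues T u v hb hu hv hN
    have h4 := (h2 ⟨i + 1, by omega⟩).trans (h3 _ ⟨i, by omega⟩ le_rfl)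
    rwa [eigenvalues_dilation_eq _ hN _ hi, eigenvalues_dilation_eq _ hN _ (by simp; omega)] at h4
  · rw [LinearMap.singularValues_of_finrank_le _ (by omega)]
    exact T.singularValues_nonneg i

/-- The perturbation is undone by one of the same type, with -v in place of v. -/
theorem singularValues_succ_le_add_rankOne (hb : 0 ≤ b) (hu : ‖u‖ ≤ 1) (hv : ‖v‖ ≤ 1) (i : ℕ) :
    T.singularValues (i + 1) ≤ (T + (b : ℂ) • (rankOne ℂ u v : E →ₗ[ℂ] F)).singularValues i := by
  have h := singularValues_add_rankOne_succ_le (T + (b : ℂ) • (rankOne ℂ u v : E →ₗ[ℂ] F)) u (-v)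
    hb hu (by simpa using hv) i
  have h1 : T + (b : ℂ) • (rankOne ℂ u v : E →ₗ[ℂ] F) + (b : ℂ) • (rankOne ℂ u (-v) : E →ₗ[ℂ] F)
      = T := by
    ext x
    simp
  rwa [h1] at h

end Dilation

/-! ### Inequalities for concave and convex functions of one variable -/

section Scalar

/-- Increments of a concave function decrease. -/
theorem concaveOn_increment_le {g : ℝ → ℝ} (hg : ConcaveOn ℝ (Set.Ici 0) g) {s w δ : ℝ}
    (hs : 0 ≤ s) (hsw : s ≤ w) (hδ : 0 ≤ δ) : g (w + δ) - g w ≤ g (s + δ) - g s := by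
  rcases hδ.eq_or_lt with rfl | hδ
  · simp
  have hD : 0 < w + δ - s := by linarith
  have hs' : s ∈ Set.Ici (0 : ℝ) := hs
  have hw' : w + δ ∈ Set.Ici (0 : ℝ) := Set.mem_Ici.2 (by linarith)
  have hp : 0 ≤ δ / (w + δ - s) := by positivity
  have hq : 0 ≤ (w - s) / (w + δ - s) := div_nonneg (by linarith) hD.le
  -- The points w and s + δ are convex combinations of s and w + δ with the two weights exchanged;
  -- adding the two concavity inequalities gives the claim.
  have h1 := hg.2 hs' hw' hp hq (by field_simp; ring)
  have h2 := hg.2 hs' hw' hq hp (by field_simp; ring)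
  have e1 : (δ / (w + δ - s)) • s + ((w - s) / (w + δ - s)) • (w + δ) = w := by
    simp only [smul_eq_mul]
    field_simp
    ring
  have e2 : ((w - s) / (w + δ - s)) • s + (δ / (w + δ - s)) • (w + δ) = s + δ := by
    simp only [smul_eq_mul]
    field_simp
    ring
  rw [e1] at h1
  rw [e2] at h2
  simp only [smul_eq_mul] at h1 h2
  have e3 : (w - s) / (w + δ - s) = 1 - δ / (w + δ - s) := by
    field_simp
    ring
  rw [e3] at h1 h2
  linarith

/-- A concave function that vanishes at `0` is subadditive over disjoint intervals. -/
theorem sum_sub_le_of_interlacing {g : ℝ → ℝ} (hg : ConcaveOn ℝ (Set.Ici 0) g) (hg0 : g 0 = 0)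
    (p : ℕ) : ∀ z w : ℕ → ℝ, (∀ i, 0 ≤ w i) → (∀ i, w i ≤ z i) → (∀ i, z (i + 1) ≤ w i) →
      ∑ i ∈ Finset.range p, (z i - w i) ≤ z 0 ∧
      ∑ i ∈ Finset.range p, (g (z i) - g (w i)) ≤ g (∑ i ∈ Finset.range p, (z i - w i)) := by
  induction p with
  | zero =>
    intro z w hw hwz _
    simpa [hg0] using (hw 0).trans (hwz 0)
  | succ p ih =>
    intro z w hw hwz hzw
    obtain ⟨h1, h2⟩ := ih (fun i => z (i + 1)) (fun i => w (i + 1)) (fun i => hw _)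
      (fun i => hwz _) (fun i => hzw _)
    rw [Finset.sum_range_succ', Finset.sum_range_succ']
    set s := ∑ i ∈ Finset.range p, (z (i + 1) - w (i + 1)) with hs
    have hs0 : 0 ≤ s := Finset.sum_nonneg fun i _ => sub_nonneg.2 (hwz _)
    -- The intervals above index 0 all lie below w 0, so the top interval may be moved down to start
    -- at their total length s.
    have hsw : s ≤ w 0 := h1.trans (hzw 0)
    refine ⟨by linarith, ?_⟩
    have h3 := concaveOn_increment_le hg hs0 hsw (sub_nonneg.2 (hwz 0))
    rw [add_sub_cancel] at h3
    linarith

/-- Interlacing says that the intervals from min(xᵢ, yᵢ) to max(xᵢ, yᵢ) do not overlap, whichever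
endpoint is larger at each index. -/
theorem sum_abs_sub_le_of_interlacing {g : ℝ → ℝ} (hg : ConcaveOn ℝ (Set.Ici 0) g)
    (hmono : MonotoneOn g (Set.Ici 0)) (hg0 : g 0 = 0) (p : ℕ) {x y : ℕ → ℝ}
    (hx : ∀ i, 0 ≤ x i) (hy : ∀ i, 0 ≤ y i) (hxa : Antitone x) (hya : Antitone y)
    (hxy : ∀ i, x (i + 1) ≤ y i) (hyx : ∀ i, y (i + 1) ≤ x i) :
    ∑ i ∈ Finset.range p, |g (x i) - g (y i)| ≤ g (∑ i ∈ Finset.range p, |x i - y i|) := by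
  have h := (sum_sub_le_of_interlacing hg hg0 p (fun i => max (x i) (y i))
    (fun i => min (x i) (y i)) (fun i => le_min (hx i) (hy i)) (fun i => min_le_max)
    (fun i => max_le (le_min (hxa i.le_succ) (hxy i)) (le_min (hyx i) (hya i.le_succ)))).2
  simp only [max_sub_min_eq_abs] at h
  refine le_trans (Finset.sum_le_sum fun i _ => ?_) (h.trans_eq ?_)
  · rcases le_total (x i) (y i) with h1 | h1
    · rw [max_eq_right h1, min_eq_left h1, abs_sub_comm,
        abs_of_nonneg (sub_nonneg.2 (hmono (hx i) (hy i) h1))]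
    · rw [max_eq_left h1, min_eq_right h1,
        abs_of_nonneg (sub_nonneg.2 (hmono (hy i) (hx i) h1))]
  · simp only [abs_sub_comm]

/-- Jensen's inequality with total weight at most one for a function that vanishes at `0`. -/
theorem convexOn_map_sum_le_of_sum_le_one {h : ℝ → ℝ} (hh : ConvexOn ℝ (Set.Ici 0) h)
    (h0 : h 0 = 0) {ι : Type*} [Fintype ι] {w x : ι → ℝ} (hw : ∀ i, 0 ≤ w i) (hx : ∀ i, 0 ≤ x i)
    (hw1 : ∑ i, w i ≤ 1) : h (∑ i, w i * x i) ≤ ∑ i, w i * h (x i) := by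
  -- The missing weight is placed at 0, where h vanishes.
  have := hh.map_add_sum_le (t := Finset.univ) (w := w) (p := x) (v := 1 - ∑ i, w i) (q := 0)
    (fun i _ => hw i) (by ring) (fun i _ => hx i) (by linarith) (by simp)
  simpa [h0] using this

theorem norm_le_one_of_bessel {F : Type*} [NormedAddCommGroup F] [InnerProductSpace ℂ F]
    {ι : Type*} [Fintype ι] {u : ι → F}
    (hu : ∀ y, ∑ i, ‖(inner ℂ (u i) y : ℂ)‖ ^ 2 ≤ ‖y‖ ^ 2) (i : ι) : ‖u i‖ ≤ 1 := by
  have h1 : ‖(inner ℂ (u i) (u i) : ℂ)‖ ^ 2 ≤ ‖u i‖ ^ 2 :=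
    (Finset.single_le_sum (f := fun j => ‖(inner ℂ (u j) (u i) : ℂ)‖ ^ 2)
      (fun j _ => by positivity) (Finset.mem_univ i)).trans (hu (u i))
  rw [inner_self_eq_norm_sq_to_K, norm_pow, RCLike.norm_ofReal, abs_norm] at h1
  by_contra h
  push Not at h
  nlinarith [mul_pos (pow_pos (one_pos.trans h) 2) (sub_pos.2 (one_lt_pow₀ h two_ne_zero))]

end Scalar

/-! ### Sums of functions of singular values -/

section SpectralSum

open Module InnerProductSpace

variable {E F : Type*} [NormedAddCommGroup E] [InnerProductSpace ℂ E] [FiniteDimensional ℂ E]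
  [NormedAddCommGroup F] [InnerProductSpace ℂ F] [FiniteDimensional ℂ F]

/-- The sum of the values of `h` at the singular values. -/
def spectralSum (h : ℝ → ℝ) (T : E →ₗ[ℂ] F) : ℝ :=
  ∑ i ∈ Finset.range (min (finrank ℂ F) (finrank ℂ E)), h (T.singularValues i)

/-- Indices beyond the smaller dimension carry zero singular values, so the sum may run over a full
basis of right singular vectors. -/
theorem spectralSum_eq_sum_fin {h : ℝ → ℝ} (h0 : h 0 = 0) (T : E →ₗ[ℂ] F) {n : ℕ}
    (hn : finrank ℂ E = n) : spectralSum h T = ∑ i : Fin n, h (T.singularValues i) := by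
  rw [Fin.sum_univ_eq_sum_range (fun i => h (T.singularValues i)) n, spectralSum]
  refine Finset.sum_subset (fun i hi => ?_) fun i _ hi => ?_
  · simp only [Finset.mem_range] at hi ⊢
    omega
  · rw [T.singularValues_eq_zero_iff_le_finrank_range.2, h0]
    have h1 := Submodule.finrank_le (LinearMap.range T)
    have h2 := LinearMap.finrank_range_le T
    simp only [Finset.mem_range] at hi
    omega

theorem sum_abs_le_of_rankOne {g : ℝ → ℝ} (hg : ConcaveOn ℝ (Set.Ici 0) g)
    (hmono : MonotoneOn g (Set.Ici 0)) (hg0 : g 0 = 0) (T : E →ₗ[ℂ] F) {b : ℝ} (hb : 0 ≤ b)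
    {u : F} {v : E} (hu : ‖u‖ ≤ 1) (hv : ‖v‖ ≤ 1) {p : ℕ} (hpE : p ≤ finrank ℂ E)
    (hpF : p ≤ finrank ℂ F) :
    ∑ i ∈ Finset.range p, |g ((T + (b : ℂ) • (rankOne ℂ u v : E →ₗ[ℂ] F)).singularValues i)
      - g (T.singularValues i)| ≤ g b := by
  refine (sum_abs_sub_le_of_interlacing hg hmono hg0 p (LinearMap.singularValues_nonneg _)
    T.singularValues_nonneg (LinearMap.singularValues_antitone _) T.singularValues_antitone
    (singularValues_add_rankOne_succ_le T u v hb hu hv)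
    (singularValues_succ_le_add_rankOne T u v hb hu hv)).trans ?_
  exact hmono (Set.mem_Ici.2 (Finset.sum_nonneg fun i _ => abs_nonneg _)) hb
    (sum_abs_singularValues_sub_le T u v hb hu hv hpE hpF)

/-- Telescoping: the rank one terms are added one at a time, with the triangle inequality at each
index. -/
theorem sum_abs_le_of_sum_rankOne {g : ℝ → ℝ} (hg : ConcaveOn ℝ (Set.Ici 0) g)
    (hmono : MonotoneOn g (Set.Ici 0)) (hg0 : g 0 = 0) (T : E →ₗ[ℂ] F) {ι : Type*}
    (s : Finset ι) {b : ι → ℝ} (hb : ∀ k, 0 ≤ b k)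
    {u : ι → F} {v : ι → E} (hu : ∀ k, ‖u k‖ ≤ 1) (hv : ∀ k, ‖v k‖ ≤ 1) {p : ℕ}
    (hpE : p ≤ finrank ℂ E) (hpF : p ≤ finrank ℂ F) :
    ∑ i ∈ Finset.range p,
      |g ((T + ∑ k ∈ s, (b k : ℂ) • (rankOne ℂ (u k) (v k) : E →ₗ[ℂ] F)).singularValues i)
      - g (T.singularValues i)| ≤ ∑ k ∈ s, g (b k) := by
  classical
  induction s using Finset.induction_on with
  | empty => simp
  | insert a s ha ih =>
    rw [Finset.sum_insert ha, Finset.sum_insert ha, add_comm (_ • _), ← add_assoc]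
    have h1 := sum_abs_le_of_rankOne hg hmono hg0
      (T + ∑ k ∈ s, (b k : ℂ) • (rankOne ℂ (u k) (v k) : E →ₗ[ℂ] F)) (hb a) (hu a) (hv a) hpE hpF
    refine le_trans ?_ (add_le_add h1 ih)
    rw [← Finset.sum_add_distrib]
    exact Finset.sum_le_sum fun i _ => abs_sub_le _ _ _

/-- Singular value decomposition with Bessel's inequality for the left singular vectors. -/
theorem exists_svd_bessel (T : E →ₗ[ℂ] F) {n : ℕ} (hn : finrank ℂ E = n) :
    ∃ (e : OrthonormalBasis (Fin n) ℂ E) (u : Fin n → F),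
      (∀ i, T (e i) = (T.singularValues i : ℂ) • u i) ∧
      (∀ y, ∑ i, ‖(inner ℂ (u i) y : ℂ)‖ ^ 2 ≤ ‖y‖ ^ 2) ∧
      (∀ i, inner ℂ (u i) (T (e i)) = (T.singularValues i : ℂ)) ∧
      (∀ i, ‖T (e i)‖ = T.singularValues i) := by
  obtain ⟨e, u, hTe, -, huo, hu1, hu0⟩ := exists_svd T hn
  refine ⟨e, u, hTe, fun y => ?_, fun i => ?_, fun i => ?_⟩
  · let w : {i : Fin n // T.singularValues i ≠ 0} → F := fun i => u i
    have hw : Orthonormal ℂ w :=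
      ⟨fun i => hu1 _ i.2, fun i j hij => huo _ _ fun h => hij (Subtype.ext h)⟩
    have h1 := hw.sum_inner_products_le y (s := Finset.univ)
    refine le_trans (le_of_eq ?_) h1
    rw [← Finset.sum_filter_of_ne (s := Finset.univ)
      (p := fun i : Fin n => T.singularValues i ≠ 0) fun i _ hi h => hi (by simp [hu0 i h])]
    exact Finset.sum_subtype _ (by simp) _
  · rw [hTe, inner_smul_right]
    by_cases h : T.singularValues i = 0
    · simp [h]
    · rw [inner_self_eq_norm_sq_to_K, hu1 i h]
      simp
  · rw [hTe, norm_smul, Complex.norm_real, Real.norm_of_nonneg (T.singularValues_nonneg i)]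
    by_cases h : T.singularValues i = 0
    · simp [h]
    · rw [hu1 i h, mul_one]

/-- The perturbation inequality for concave functions of singular values. -/
theorem sum_abs_sub_le_spectralSum {g : ℝ → ℝ} (hg : ConcaveOn ℝ (Set.Ici 0) g)
    (hmono : MonotoneOn g (Set.Ici 0)) (hg0 : g 0 = 0) (T B : E →ₗ[ℂ] F) :
    ∑ i ∈ Finset.range (min (finrank ℂ F) (finrank ℂ E)),
      |g ((T + B).singularValues i) - g (T.singularValues i)| ≤ spectralSum g B := by
  obtain ⟨e, u, hBe, hu, -⟩ := exists_svd_bessel B (n := finrank ℂ E) rfl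
  have hB : B = ∑ k : Fin (finrank ℂ E),
      ((B.singularValues k : ℝ) : ℂ) • (rankOne ℂ (u k) (e k) : E →ₗ[ℂ] F) := by
    refine e.toBasis.ext fun i => ?_
    simp [LinearMap.sum_apply, hBe, orthonormal_iff_ite.1 e.orthonormal]
  have h := sum_abs_le_of_sum_rankOne hg hmono hg0 T Finset.univ
    (b := fun k : Fin (finrank ℂ E) => B.singularValues k)
    (fun k => B.singularValues_nonneg k) (fun k => norm_le_one_of_bessel hu k)
    (fun k => (e.norm_eq_one k).le) (min_le_right (finrank ℂ F) (finrank ℂ E)) (min_le_left _ _)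
  rw [← hB] at h
  rwa [spectralSum_eq_sum_fin hg0 B rfl]

/-- Diagonal values with respect to Bessel systems are dominated by singular values. -/
theorem sum_norm_inner_le_spectralSum {h : ℝ → ℝ} (hh : ConvexOn ℝ (Set.Ici 0) h)
    (hmono : MonotoneOn h (Set.Ici 0)) (h0 : h 0 = 0) (A : E →ₗ[ℂ] F) {ι : Type*} [Fintype ι]
    {u : ι → F} {v : ι → E} (hu : ∀ y, ∑ i, ‖(inner ℂ (u i) y : ℂ)‖ ^ 2 ≤ ‖y‖ ^ 2)
    (hv : ∀ y, ∑ i, ‖(inner ℂ (v i) y : ℂ)‖ ^ 2 ≤ ‖y‖ ^ 2) :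
    ∑ j, h ‖(inner ℂ (u j) (A (v j)) : ℂ)‖ ≤ spectralSum h A := by
  obtain ⟨e, a, hAe, ha, -⟩ := exists_svd_bessel A (n := finrank ℂ E) rfl
  have hu1 := norm_le_one_of_bessel hu
  have hv1 := norm_le_one_of_bessel hv
  have ha1 := norm_le_one_of_bessel ha
  set σ : Fin (finrank ℂ E) → ℝ := fun i => A.singularValues i with hσ
  have hσ0 : ∀ i, 0 ≤ σ i := fun i => A.singularValues_nonneg i
  have hh0 : ∀ x, 0 ≤ x → 0 ≤ h x := fun x hx => by
    rw [← h0]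
    exact hmono (by simp) hx hx
  -- Expanding A in its singular vectors gives products of two coefficients; bounding each product
  -- by the mean of the squares yields weights whose row and column sums are at most one. Rows serve
  -- Jensen, columns the final summation.
  let w : ι → Fin (finrank ℂ E) → ℝ := fun j i =>
    (‖(inner ℂ (e i) (v j) : ℂ)‖ ^ 2 + ‖(inner ℂ (a i) (u j) : ℂ)‖ ^ 2) / 2
  have hw0 : ∀ j i, 0 ≤ w j i := fun j i => by positivity
  have hrow : ∀ j, ∑ i, w j i ≤ 1 := by
    intro j
    rw [← Finset.sum_div, Finset.sum_add_distrib, e.sum_sq_norm_inner_right]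
    have h1 := ha (u j)
    have h2 := pow_le_one₀ (n := 2) (norm_nonneg _) (hu1 j)
    have h3 := pow_le_one₀ (n := 2) (norm_nonneg _) (hv1 j)
    linarith
  have hcol : ∀ i, ∑ j, w j i ≤ 1 := by
    intro i
    rw [← Finset.sum_div, Finset.sum_add_distrib]
    have h1 := hu (a i)
    have h2 := hv (e i)
    have h3 := pow_le_one₀ (n := 2) (norm_nonneg _) (ha1 i)
    rw [e.norm_eq_one] at h2
    simp only [norm_inner_symm (e i), norm_inner_symm (a i)]
    linarith
  have hle : ∀ j, ‖(inner ℂ (u j) (A (v j)) : ℂ)‖ ≤ ∑ i, w j i * σ i := by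
    intro j
    have h1 : A (v j) = ∑ i, (inner ℂ (e i) (v j) : ℂ) • ((σ i : ℂ) • a i) := by
      conv_lhs => rw [← e.sum_repr' (v j)]
      rw [map_sum]
      simp only [map_smul, hAe, hσ]
    rw [h1, inner_sum]
    refine (norm_sum_le _ _).trans (Finset.sum_le_sum fun i _ => ?_)
    rw [inner_smul_right, inner_smul_right, norm_mul, norm_mul, Complex.norm_real,
      Real.norm_of_nonneg (hσ0 i), norm_inner_symm (u j)]
    have := hσ0 i
    simp only [w]
    nlinarith [mul_nonneg this
      (sq_nonneg (‖(inner ℂ (e i) (v j) : ℂ)‖ - ‖(inner ℂ (a i) (u j) : ℂ)‖))]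
  calc ∑ j, h ‖(inner ℂ (u j) (A (v j)) : ℂ)‖ ≤ ∑ j, ∑ i, w j i * h (σ i) := by
        refine Finset.sum_le_sum fun j _ => ?_
        refine (hmono (norm_nonneg _) ?_ (hle j)).trans
          (convexOn_map_sum_le_of_sum_le_one hh h0 (hw0 j) hσ0 (hrow j))
        exact Finset.sum_nonneg fun i _ => mul_nonneg (hw0 j i) (hσ0 i)
    _ = ∑ i, (∑ j, w j i) * h (σ i) := by
        rw [Finset.sum_comm]
        simp only [Finset.sum_mul]
    _ ≤ ∑ i, h (σ i) := Finset.sum_le_sum fun i _ =>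
        mul_le_of_le_one_left (hh0 _ (hσ0 i)) (hcol i)
    _ = spectralSum h A := (spectralSum_eq_sum_fin h0 A rfl).symm

/-- Convex nondecreasing functions of the singular values are convex. -/
theorem convexOn_spectralSum {h : ℝ → ℝ} (hh : ConvexOn ℝ (Set.Ici 0) h)
    (hmono : MonotoneOn h (Set.Ici 0)) (h0 : h 0 = 0) (A B : E →ₗ[ℂ] F) {a b : ℝ} (ha : 0 ≤ a)
    (hb : 0 ≤ b) (hab : a + b = 1) :
    spectralSum h ((a : ℂ) • A + (b : ℂ) • B) ≤ a * spectralSum h A + b * spectralSum h B := by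
  set M := (a : ℂ) • A + (b : ℂ) • B with hM
  obtain ⟨e, u, -, hu, hin, -⟩ := exists_svd_bessel M (n := finrank ℂ E) rfl
  have he : ∀ y, ∑ i, ‖(inner ℂ (e i) y : ℂ)‖ ^ 2 ≤ ‖y‖ ^ 2 := fun y =>
    (e.sum_sq_norm_inner_right y).le
  have hA := sum_norm_inner_le_spectralSum hh hmono h0 A hu he
  have hB := sum_norm_inner_le_spectralSum hh hmono h0 B hu he
  calc spectralSum h M ≤ ∑ j, (a * h ‖(inner ℂ (u j) (A (e j)) : ℂ)‖ +
        b * h ‖(inner ℂ (u j) (B (e j)) : ℂ)‖) := by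
        rw [spectralSum_eq_sum_fin h0 M rfl]
        refine Finset.sum_le_sum fun j _ => ?_
        refine le_trans (hmono (M.singularValues_nonneg j) (Set.mem_Ici.2 (by positivity)) ?_)
          (hh.2 (norm_nonneg (inner ℂ (u j) (A (e j)) : ℂ))
            (norm_nonneg (inner ℂ (u j) (B (e j)) : ℂ)) ha hb hab)
        have h1 : M.singularValues j = ‖(inner ℂ (u j) (M (e j)) : ℂ)‖ := by
          rw [hin, Complex.norm_real, Real.norm_of_nonneg (M.singularValues_nonneg j)]
        rw [h1, hM, LinearMap.add_apply, inner_add_right, LinearMap.smul_apply,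
          LinearMap.smul_apply, inner_smul_right, inner_smul_right]
        refine (norm_add_le _ _).trans_eq ?_
        rw [norm_mul, norm_mul, Complex.norm_real, Complex.norm_real, Real.norm_of_nonneg ha,
          Real.norm_of_nonneg hb]
        rfl
    _ ≤ a * spectralSum h A + b * spectralSum h B := by
        rw [Finset.sum_add_distrib, ← Finset.mul_sum, ← Finset.mul_sum]
        gcongr

theorem norm_apply_le_singularValues_zero (T : E →ₗ[ℂ] F) (x : E) :
    ‖T x‖ ≤ T.singularValues 0 * ‖x‖ := by
  by_cases hx : x = 0
  · simp [hx]
  have hx' : 0 < ‖x‖ := norm_pos_iff.2 hx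
  rw [← div_le_iff₀ hx']
  refine le_singularValues (Submodule.span ℂ {x}) (by rw [finrank_span_singleton hx]; simp) ?_
  intro y hy
  obtain ⟨c, rfl⟩ := Submodule.mem_span_singleton.1 hy
  rw [map_smul, norm_smul, norm_smul]
  apply le_of_eq
  field_simp

theorem singularValues_zero_le (T : E →ₗ[ℂ] F) {c : ℝ} (hc : 0 ≤ c) (h : ∀ x, ‖T x‖ ≤ c * ‖x‖) :
    T.singularValues 0 ≤ c := by
  by_cases hn : 0 < finrank ℂ E
  · obtain ⟨e, -, -, -, -, hnorm⟩ := exists_svd_bessel T (n := finrank ℂ E) rfl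
    have h1 := h (e ⟨0, hn⟩)
    rwa [hnorm, e.norm_eq_one, mul_one] at h1
  · rw [T.singularValues_of_finrank_le (by omega)]
    exact hc

/-- Shows that the sum does not depend on the basis, so a basis of singular vectors may replace the
standard one. -/
theorem sum_inner_apply_eq_trace {ι : Type*} [Fintype ι] (f : OrthonormalBasis ι ℂ E)
    (D T : E →ₗ[ℂ] F) :
    ∑ i, inner ℂ (D (f i)) (T (f i)) = (LinearMap.adjoint D ∘ₗ T).trace ℂ E := by
  rw [LinearMap.trace_eq_sum_inner _ f]
  simp only [LinearMap.comp_apply, LinearMap.adjoint_inner_right]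

/-- Trace duality between the spectral norm and the nuclear norm. -/
theorem norm_sum_inner_le {ι : Type*} [Fintype ι] (f : OrthonormalBasis ι ℂ E)
    (D T : E →ₗ[ℂ] F) : ‖∑ i, (inner ℂ (D (f i)) (T (f i)) : ℂ)‖ ≤
      D.singularValues 0 * spectralSum id T := by
  obtain ⟨e, -, -, -, -, hnorm⟩ := exists_svd_bessel T (n := finrank ℂ E) rfl
  rw [sum_inner_apply_eq_trace, ← sum_inner_apply_eq_trace e, spectralSum_eq_sum_fin rfl T rfl,
    Finset.mul_sum]
  refine (norm_sum_le _ _).trans (Finset.sum_le_sum fun i _ => ?_)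
  refine (norm_inner_le_norm _ _).trans ?_
  rw [hnorm]
  have := norm_apply_le_singularValues_zero D (e i)
  rw [e.norm_eq_one, mul_one] at this
  exact mul_le_mul_of_nonneg_right this (T.singularValues_nonneg i)

theorem spectralSum_sq {ι : Type*} [Fintype ι] (f : OrthonormalBasis ι ℂ E) (T : E →ₗ[ℂ] F) :
    spectralSum (fun x => x ^ 2) T = ∑ i, ‖T (f i)‖ ^ 2 := by
  obtain ⟨e, -, -, -, -, hnorm⟩ := exists_svd_bessel T (n := finrank ℂ E) rfl
  have h1 := (sum_inner_apply_eq_trace f T T).trans (sum_inner_apply_eq_trace e T T).symm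
  simp only [inner_self_eq_norm_sq_to_K] at h1
  rw [spectralSum_eq_sum_fin (by norm_num) T rfl]
  simp only [← hnorm]
  apply Complex.ofReal_injective
  push_cast
  exact h1.symm

theorem singularValues_neg (T : E →ₗ[ℂ] F) : (-T).singularValues = T.singularValues := by
  have h : ∀ (S S' : E →ₗ[ℂ] E) (hS : S.IsSymmetric) (hS' : S'.IsSymmetric), S = S' →
      hS.eigenvalues rfl = hS'.eigenvalues rfl := by
    rintro S _ hS hS' rfl
    rfl
  ext i
  by_cases hi : i < finrank ℂ E
  · rw [LinearMap.singularValues_of_lt _ rfl hi, LinearMap.singularValues_of_lt _ rfl hi,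
      h _ _ (-T).isSymmetric_adjoint_comp_self T.isSymmetric_adjoint_comp_self (by ext; simp)]
  · rw [LinearMap.singularValues_of_finrank_le _ (not_lt.1 hi),
      LinearMap.singularValues_of_finrank_le _ (not_lt.1 hi)]

theorem spectralSum_add_le {g : ℝ → ℝ} (hg : ConcaveOn ℝ (Set.Ici 0) g)
    (hmono : MonotoneOn g (Set.Ici 0)) (hg0 : g 0 = 0) (T B : E →ₗ[ℂ] F) :
    spectralSum g (T + B) ≤ spectralSum g T + spectralSum g B := by
  have h1 : spectralSum g (T + B) - spectralSum g T ≤ spectralSum g B := by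
    refine le_trans ?_ (sum_abs_sub_le_spectralSum hg hmono hg0 T B)
    rw [spectralSum, spectralSum, ← Finset.sum_sub_distrib]
    exact Finset.sum_le_sum fun i _ => le_abs_self _
  linarith

/-- Comparison of a map `A` with a perturbation `A + V`: beyond the rank of `A`, the singular values
of `V` contribute negatively. -/
theorem spectralSum_sub_add_half_le {g : ℝ → ℝ} (hg : ConcaveOn ℝ (Set.Ici 0) g)
    (hmono : MonotoneOn g (Set.Ici 0)) (hg0 : g 0 = 0) (A V : E →ₗ[ℂ] F) :
    spectralSum g A - spectralSum g (A + V) + 1 / 2 * spectralSum g V ≤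
      3 / 2 * ∑ i ∈ (Finset.range (min (finrank ℂ F) (finrank ℂ E))).filter
        (· < finrank ℂ (LinearMap.range A)), g (V.singularValues i) := by
  -- Perturbing -V by A + V gives A, so G(A + V) bounds the distance between the spectra of A and V.
  -- Beyond the rank of A each term of that distance is g(σᵢ(V)), which outweighs the added half.
  have h := sum_abs_sub_le_spectralSum hg hmono hg0 (-V) (A + V)
  rw [show -V + (A + V) = A by abel, singularValues_neg] at h
  refine le_trans (add_le_add (sub_le_sub_left h _) le_rfl) ?_
  rw [Finset.sum_filter, spectralSum, spectralSum, Finset.mul_sum, Finset.mul_sum,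
    ← Finset.sum_sub_distrib, ← Finset.sum_add_distrib]
  refine Finset.sum_le_sum fun i _ => ?_
  have h0 : 0 ≤ g (V.singularValues i) := by
    rw [← hg0]
    exact hmono (by simp) (V.singularValues_nonneg i) (V.singularValues_nonneg i)
  split_ifs with hi
  · linarith [le_abs_self (g (A.singularValues i) - g (V.singularValues i))]
  · rw [A.singularValues_eq_zero_iff_le_finrank_range.2 (not_lt.1 hi), hg0, zero_sub (g _), abs_neg,
      abs_of_nonneg h0]
    linarith

end SpectralSum

/-! ### Linear bounds and weak convexity of the penalty -/

namespace PenaltyAssumption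

variable {g : ℝ → ℝ} {lam k₀ μ : ℝ}

theorem continuous (hg : PenaltyAssumption g lam k₀ μ) : Continuous g := by
  rw [continuous_iff_continuousAt]
  intro x
  by_cases hx : x = 0
  · exact hx ▸ hg.continuousAt_zero
  · exact (hg.diff x hx).continuousAt

/-- The convexified penalty `g + μ/2 x²`. -/
theorem convexOn_add_sq (hg : PenaltyAssumption g lam k₀ μ) :
    ConvexOn ℝ (Set.Ici 0) (fun x => g x + μ / 2 * x ^ 2) := by
  have hc : Continuous (fun x => g x + μ / 2 * x ^ 2) := by
    have := hg.continuous
    fun_prop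
  refine ⟨convex_Ici 0, fun x hx y hy a b ha hb hab => ?_⟩
  have hx' : (0 : ℝ) ≤ x := hx
  have hy' : (0 : ℝ) ≤ y := hy
  set h := fun x => g x + μ / 2 * x ^ 2 with hh
  -- Convexity is assumed on the open half-line only; both points are shifted inside by ε, and
  -- continuity at 0 closes the gap.
  have h1 : Tendsto (fun ε : ℝ => h (a • (x + ε) + b • (y + ε))) (𝓝[>] 0)
      (𝓝 (h (a • x + b • y))) := by
    have : Continuous fun ε : ℝ => h (a • (x + ε) + b • (y + ε)) := by fun_prop
    simpa using (this.tendsto 0).mono_left nhdsWithin_le_nhds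
  have h2 : Tendsto (fun ε : ℝ => a • h (x + ε) + b • h (y + ε)) (𝓝[>] 0)
      (𝓝 (a • h x + b • h y)) := by
    have : Continuous fun ε : ℝ => a • h (x + ε) + b • h (y + ε) := by fun_prop
    simpa using (this.tendsto 0).mono_left nhdsWithin_le_nhds
  refine le_of_tendsto_of_tendsto h1 h2 ?_
  filter_upwards [self_mem_nhdsWithin] with ε hε
  have hε' : (0 : ℝ) < ε := hε
  exact hg.weakConvex.2 (Set.mem_Ioi.2 (by linarith)) (Set.mem_Ioi.2 (by linarith)) ha hb hab

theorem monotoneOn_add_sq (hg : PenaltyAssumption g lam k₀ μ) :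
    MonotoneOn (fun x => g x + μ / 2 * x ^ 2) (Set.Ici 0) := by
  intro x hx y hy hxy
  have hx' : (0 : ℝ) ≤ x := hx
  have h1 := hg.mono hx hy hxy
  have h2 := mul_le_mul_of_nonneg_left (pow_le_pow_left₀ hx' hxy 2) (half_pos hg.μ_pos).le
  simp only
  linarith

theorem le_mul (hg : PenaltyAssumption g lam k₀ μ) {x : ℝ} (hx : 0 ≤ x) : g x ≤ lam * k₀ * x := by
  rcases hx.eq_or_lt with rfl | hx
  · simp [hg.map_zero]
  obtain ⟨c, hc, hcx⟩ := exists_deriv_eq_slope g hx hg.continuous.continuousOn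
    fun y hy => (hg.diff y hy.1.ne').differentiableWithinAt
  have h1 := hg.deriv_le c hc.1
  rw [hcx, hg.map_zero, sub_zero, sub_zero, div_le_iff₀ hx] at h1
  exact h1

/-- The derivative of the convexified penalty is nondecreasing on the positive axis and tends to λk₀
at 0, so it is at least λk₀ throughout; the mean value theorem concludes. -/
theorem mul_le_add_sq (hg : PenaltyAssumption g lam k₀ μ) {x : ℝ} (hx : 0 ≤ x) :
    lam * k₀ * x ≤ g x + μ / 2 * x ^ 2 := by
  rcases hx.eq_or_lt with rfl | hx
  · simp [hg.map_zero]
  set h := fun x => g x + μ / 2 * x ^ 2 with hh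
  have hd : ∀ y, y ≠ 0 → HasDerivAt h (deriv g y + μ * y) y := by
    intro y hy
    have h1 := (hg.diff y hy).hasDerivAt.add ((hasDerivAt_pow 2 y).const_mul (μ / 2))
    exact h1.congr_deriv (by push_cast; ring)
  have hc : Continuous h := by
    have := hg.continuous
    fun_prop
  obtain ⟨c, hcm, hcx⟩ := exists_deriv_eq_slope h hx hc.continuousOn
    fun y hy => (hd y hy.1.ne').differentiableAt.differentiableWithinAt
  have h0 : h 0 = 0 := by simp [hh, hg.map_zero]
  rw [h0, sub_zero, sub_zero, eq_div_iff hx.ne'] at hcx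
  have hlim : Tendsto (deriv h) (𝓝[>] 0) (𝓝 (lam * k₀)) := by
    have h1 : Tendsto (fun y => deriv g y + μ * y) (𝓝[>] 0) (𝓝 (lam * k₀ + μ * 0)) :=
      hg.deriv_lim.add ((tendsto_id.mono_left nhdsWithin_le_nhds).const_mul μ)
    rw [mul_zero, add_zero] at h1
    refine h1.congr' ?_
    filter_upwards [self_mem_nhdsWithin] with y hy
    exact (hd y (ne_of_gt hy)).deriv.symm
  have hmono : MonotoneOn (deriv h) (Set.Ioi 0) :=
    hg.weakConvex.monotoneOn_deriv fun y hy => (hd y (ne_of_gt hy)).differentiableAt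
  have hle : lam * k₀ ≤ deriv h c := by
    refine le_of_tendsto hlim ?_
    filter_upwards [Ioo_mem_nhdsGT hcm.1] with y hy
    exact hmono hy.1 hcm.1 hy.2.le
  calc lam * k₀ * x ≤ deriv h c * x := mul_le_mul_of_nonneg_right hle hx.le
    _ = h x := hcx

end PenaltyAssumption

/-! ### Transformed tensors: norms, duality and the regularizer -/

section TensorSum

open Module

variable {n₁ n₂ n₃ : ℕ} (U : Matrix (Fin n₃) (Fin n₃) ℂ)

/-- The `k`-th transformed frontal slice as a linear map between Euclidean spaces. -/
def sliceMap (X : Tensor n₁ n₂ n₃) (k : Fin n₃) :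
    EuclideanSpace ℂ (Fin n₂) →ₗ[ℂ] EuclideanSpace ℂ (Fin n₁) :=
  Matrix.toEuclideanLin (transformedSlice U X k)

theorem sliceMap_add (X Y : Tensor n₁ n₂ n₃) (k : Fin n₃) :
    sliceMap U (X + Y) k = sliceMap U X k + sliceMap U Y k := by
  rw [sliceMap, sliceMap, sliceMap, ← map_add]
  congr 1
  ext i j
  simp [transformedSlice, mul_add, Finset.sum_add_distrib]

theorem sliceMap_smul (s : ℝ) (X : Tensor n₁ n₂ n₃) (k : Fin n₃) :
    sliceMap U (s • X) k = (s : ℂ) • sliceMap U X k := by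
  rw [sliceMap, sliceMap, ← map_smul]
  congr 1
  ext i j
  simp only [transformedSlice, PiLp.smul_apply, smul_eq_mul, Complex.ofReal_mul, Matrix.of_apply,
    Matrix.smul_apply, Finset.mul_sum]
  exact Finset.sum_congr rfl fun l _ => by ring

/-- The sum of the values of `h` at the singular values of all transformed frontal slices. -/
def tensorSum (h : ℝ → ℝ) (X : Tensor n₁ n₂ n₃) : ℝ :=
  ∑ k, spectralSum h (sliceMap U X k)

theorem ttnn_eq_tensorSum (X : Tensor n₁ n₂ n₃) : ttnn U X = tensorSum U id X := by
  simp [ttnn, nuclearNorm, tensorSum, spectralSum, sliceMap, singVal]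

theorem regularizer_eq_tensorSum (g : ℝ → ℝ) (X : Tensor n₁ n₂ n₃) :
    regularizer U g X = tensorSum U g X := by
  simp [regularizer, tensorSum, spectralSum, sliceMap, singVal]

theorem tensorSum_add (g h : ℝ → ℝ) (X : Tensor n₁ n₂ n₃) :
    tensorSum U (fun x => g x + h x) X = tensorSum U g X + tensorSum U h X := by
  simp [tensorSum, spectralSum, Finset.sum_add_distrib]

theorem tensorSum_const_mul (c : ℝ) (h : ℝ → ℝ) (X : Tensor n₁ n₂ n₃) :
    tensorSum U (fun x => c * h x) X = c * tensorSum U h X := by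
  simp [tensorSum, spectralSum, Finset.mul_sum]

theorem tensorSum_mono {g h : ℝ → ℝ} (hgh : ∀ x, 0 ≤ x → g x ≤ h x) (X : Tensor n₁ n₂ n₃) :
    tensorSum U g X ≤ tensorSum U h X :=
  Finset.sum_le_sum fun _ _ => Finset.sum_le_sum fun _ _ =>
    hgh _ (LinearMap.singularValues_nonneg _ _)

theorem tensorSum_nonneg {g : ℝ → ℝ} (hg : ∀ x, 0 ≤ x → 0 ≤ g x) (X : Tensor n₁ n₂ n₃) :
    0 ≤ tensorSum U g X :=
  Finset.sum_nonneg fun _ _ => Finset.sum_nonneg fun _ _ =>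
    hg _ (LinearMap.singularValues_nonneg _ _)

theorem tensorSum_add_le {g : ℝ → ℝ} (hg : ConcaveOn ℝ (Set.Ici 0) g)
    (hmono : MonotoneOn g (Set.Ici 0)) (hg0 : g 0 = 0) (X Y : Tensor n₁ n₂ n₃) :
    tensorSum U g (X + Y) ≤ tensorSum U g X + tensorSum U g Y := by
  rw [tensorSum, tensorSum, tensorSum, ← Finset.sum_add_distrib]
  refine Finset.sum_le_sum fun k _ => ?_
  rw [sliceMap_add]
  exact spectralSum_add_le hg hmono hg0 _ _

theorem tensorSum_convex {h : ℝ → ℝ} (hh : ConvexOn ℝ (Set.Ici 0) h)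
    (hmono : MonotoneOn h (Set.Ici 0)) (h0 : h 0 = 0) (X Y : Tensor n₁ n₂ n₃) {a b : ℝ}
    (ha : 0 ≤ a) (hb : 0 ≤ b) (hab : a + b = 1) :
    tensorSum U h (a • X + b • Y) ≤ a * tensorSum U h X + b * tensorSum U h Y := by
  rw [tensorSum, tensorSum, tensorSum, Finset.mul_sum, Finset.mul_sum, ← Finset.sum_add_distrib]
  refine Finset.sum_le_sum fun k _ => ?_
  rw [sliceMap_add, sliceMap_smul, sliceMap_smul]
  exact convexOn_spectralSum hh hmono h0 _ _ ha hb hab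

theorem tensorSum_neg (h : ℝ → ℝ) (X : Tensor n₁ n₂ n₃) :
    tensorSum U h (-X) = tensorSum U h X := by
  refine Finset.sum_congr rfl fun k _ => ?_
  have h1 : sliceMap U (-X) k = - sliceMap U X k := by
    rw [← neg_one_smul ℝ X, sliceMap_smul]
    simp
  rw [h1, spectralSum, spectralSum, singularValues_neg]

theorem ttnn_add_le (X Y : Tensor n₁ n₂ n₃) : ttnn U (X + Y) ≤ ttnn U X + ttnn U Y := by
  simp only [ttnn_eq_tensorSum]
  exact tensorSum_add_le U (concaveOn_id (convex_Ici 0)) (monotone_id.monotoneOn _) rfl X Y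

theorem ttnn_neg (X : Tensor n₁ n₂ n₃) : ttnn U (-X) = ttnn U X := by
  simp only [ttnn_eq_tensorSum, tensorSum_neg]

theorem ttnn_nonneg (X : Tensor n₁ n₂ n₃) : 0 ≤ ttnn U X := by
  rw [ttnn_eq_tensorSum]
  exact tensorSum_nonneg U (fun _ hx => hx) X

theorem ttnn_smul_of_nonneg {s : ℝ} (hs : 0 ≤ s) (hs1 : s ≤ 1) (X : Tensor n₁ n₂ n₃) :
    ttnn U (s • X) ≤ s * ttnn U X := by
  have h := tensorSum_convex U (h := id) (convexOn_id (convex_Ici 0)) (monotone_id.monotoneOn _) rfl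
    X 0 hs (sub_nonneg.2 hs1) (by ring)
  have h0 : tensorSum U id (0 : Tensor n₁ n₂ n₃) = 0 := by
    have h1 : ∀ k, sliceMap U (0 : Tensor n₁ n₂ n₃) k = 0 := fun k => by
      simpa using sliceMap_smul U 0 (0 : Tensor n₁ n₂ n₃) k
    simp [tensorSum, h1, spectralSum]
  simpa [ttnn_eq_tensorSum, h0] using h

theorem tensorSpectralNorm_nonneg (X : Tensor n₁ n₂ n₃) : 0 ≤ tensorSpectralNorm U X :=
  LinearMap.singularValues_nonneg _ _

theorem singularValues_sliceMap_le (X : Tensor n₁ n₂ n₃) (k : Fin n₃) :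
    (sliceMap U X k).singularValues 0 ≤ tensorSpectralNorm U X := by
  refine singularValues_zero_le _ (tensorSpectralNorm_nonneg U X) fun x => ?_
  set B := Matrix.blockDiagonal fun k : Fin n₃ => transformedSlice U X k with hB
  -- Padding x by zeros outside block k preserves its norm, and the k-th block of the image is the
  -- slice applied to x.
  let y : EuclideanSpace ℂ (Fin n₂ × Fin n₃) :=
    WithLp.toLp 2 fun p => if p.2 = k then x p.1 else 0
  have hy : ‖y‖ = ‖x‖ := by
    rw [EuclideanSpace.norm_eq, EuclideanSpace.norm_eq, Fintype.sum_prod_type]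
    congr 1
    refine Finset.sum_congr rfl fun j _ => ?_
    rw [Finset.sum_eq_single k] <;> simp +contextual [y]
  have hle : ‖sliceMap U X k x‖ ≤ ‖Matrix.toEuclideanLin B y‖ := by
    rw [EuclideanSpace.norm_eq, EuclideanSpace.norm_eq]
    refine Real.sqrt_le_sqrt ?_
    rw [Fintype.sum_prod_type]
    refine Finset.sum_le_sum fun i _ => ?_
    refine le_trans (le_of_eq ?_) (Finset.single_le_sum
      (f := fun l => ‖(Matrix.toEuclideanLin B y) (i, l)‖ ^ 2) (fun l _ => by positivity)
      (Finset.mem_univ k))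
    simp only [sliceMap, Matrix.ofLp_toLpLin, Matrix.toLin'_apply, Matrix.mulVec, dotProduct, hB,
      Fintype.sum_prod_type, Matrix.blockDiagonal_apply]
    congr 2
    refine Finset.sum_congr rfl fun j _ => ?_
    rw [Finset.sum_eq_single k] <;> simp +contextual [y]
  refine hle.trans ?_
  rw [← hy]
  exact norm_apply_le_singularValues_zero _ _

variable {U}

/-- The unitary transform preserves the inner product. -/
theorem inner_eq_sum_sliceMap (hU : U ∈ Matrix.unitaryGroup (Fin n₃) ℂ) (D V : Tensor n₁ n₂ n₃) :
    ((inner ℝ D V : ℝ) : ℂ) = ∑ k, ∑ j : Fin n₂,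
      inner ℂ (sliceMap U D k (EuclideanSpace.basisFun (Fin n₂) ℂ j))
        (sliceMap U V k (EuclideanSpace.basisFun (Fin n₂) ℂ j)) := by
  have hcol : ∀ (X : Tensor n₁ n₂ n₃) k j i,
      (sliceMap U X k (EuclideanSpace.basisFun (Fin n₂) ℂ j)) i =
        (U.mulVec fun l => ((X (i, j, l) : ℝ) : ℂ)) k := by
    intro X k j i
    simp [sliceMap, transformedSlice, Matrix.mulVec, dotProduct, Pi.single_apply]
  have hun : ∀ x y : Fin n₃ → ℂ,
      ∑ k, (starRingEnd ℂ) (U.mulVec x k) * U.mulVec y k = ∑ l, (starRingEnd ℂ) (x l) * y l := by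
    intro x y
    change star (U.mulVec x) ⬝ᵥ U.mulVec y = star x ⬝ᵥ y
    rw [Matrix.star_mulVec, Matrix.dotProduct_mulVec, Matrix.vecMul_vecMul,
      ← Matrix.star_eq_conjTranspose, Matrix.mem_unitaryGroup_iff'.1 hU, Matrix.vecMul_one]
  have h1 : ∀ k (j : Fin n₂), inner ℂ (sliceMap U D k (EuclideanSpace.basisFun (Fin n₂) ℂ j))
        (sliceMap U V k (EuclideanSpace.basisFun (Fin n₂) ℂ j)) =
      ∑ i, (starRingEnd ℂ) ((U.mulVec fun l => ((D (i, j, l) : ℝ) : ℂ)) k) *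
        (U.mulVec fun l => ((V (i, j, l) : ℝ) : ℂ)) k := by
    intro k j
    rw [PiLp.inner_apply]
    refine Finset.sum_congr rfl fun i _ => ?_
    rw [hcol, hcol, RCLike.inner_apply, mul_comm]
  simp_rw [h1]
  rw [Finset.sum_comm]
  have h2 : ∀ j : Fin n₂, ∑ k, ∑ i, (starRingEnd ℂ) ((U.mulVec fun l => ((D (i, j, l) : ℝ) : ℂ)) k)
      * (U.mulVec fun l => ((V (i, j, l) : ℝ) : ℂ)) k =
      ∑ i, ∑ l, ((D (i, j, l) * V (i, j, l) : ℝ) : ℂ) := by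
    intro j
    rw [Finset.sum_comm]
    refine Finset.sum_congr rfl fun i _ => ?_
    rw [hun]
    simp
  simp_rw [h2]
  rw [Finset.sum_comm, PiLp.inner_apply, Fintype.sum_prod_type, Complex.ofReal_sum]
  refine Finset.sum_congr rfl fun i _ => ?_
  rw [Fintype.sum_prod_type, Complex.ofReal_sum]
  refine Finset.sum_congr rfl fun j _ => ?_
  rw [Complex.ofReal_sum]
  refine Finset.sum_congr rfl fun l _ => ?_
  simp [mul_comm]

theorem tensorSum_sq (hU : U ∈ Matrix.unitaryGroup (Fin n₃) ℂ) (X : Tensor n₁ n₂ n₃) :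
    tensorSum U (fun x => x ^ 2) X = ‖X‖ ^ 2 := by
  apply Complex.ofReal_injective
  rw [← real_inner_self_eq_norm_sq, inner_eq_sum_sliceMap hU, tensorSum, Complex.ofReal_sum]
  refine Finset.sum_congr rfl fun k _ => ?_
  rw [spectralSum_sq (EuclideanSpace.basisFun (Fin n₂) ℂ), Complex.ofReal_sum]
  refine Finset.sum_congr rfl fun j _ => ?_
  rw [inner_self_eq_norm_sq_to_K]
  simp

/-- Duality between the tensor spectral norm and the transformed tensor nuclear norm. -/
theorem abs_inner_le (hU : U ∈ Matrix.unitaryGroup (Fin n₃) ℂ) (D V : Tensor n₁ n₂ n₃) :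
    |inner ℝ D V| ≤ tensorSpectralNorm U D * ttnn U V := by
  rw [← Real.norm_eq_abs, ← Complex.norm_real, inner_eq_sum_sliceMap hU, ttnn_eq_tensorSum,
    tensorSum, Finset.mul_sum]
  refine (norm_sum_le _ _).trans (Finset.sum_le_sum fun k _ => ?_)
  refine (norm_sum_inner_le _ _ _).trans ?_
  exact mul_le_mul_of_nonneg_right (singularValues_sliceMap_le U D k)
    (Finset.sum_nonneg fun i _ => LinearMap.singularValues_nonneg _ _)

/-- Cauchy-Schwarz over the chosen indices, with the unitary transform preserving the Frobenius
norm. With as many indices as the rank of each slice of X*, it produces √(∑rᵢ). -/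
theorem sum_singularValues_le (hU : U ∈ Matrix.unitaryGroup (Fin n₃) ℂ) (V : Tensor n₁ n₂ n₃)
    (S : Fin n₃ → Finset ℕ) (hS : ∀ k, S k ⊆ Finset.range (min n₁ n₂)) :
    ∑ k, ∑ i ∈ S k, (sliceMap U V k).singularValues i ≤
      √((∑ k, (S k).card : ℕ) : ℝ) * ‖V‖ := by
  rw [Finset.sum_sigma' Finset.univ S fun k i => (sliceMap U V k).singularValues i]
  have hcard : ∑ k, (S k).card = (Finset.univ.sigma S).card := (Finset.card_sigma _ _).symm
  rw [← Real.sqrt_sq (norm_nonneg V), ← Real.sqrt_mul (Nat.cast_nonneg _)]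
  refine Real.le_sqrt_of_sq_le (sq_sum_le_card_mul_sum_sq.trans ?_)
  rw [hcard, ← tensorSum_sq hU V]
  refine mul_le_mul_of_nonneg_left ?_ (Nat.cast_nonneg _)
  rw [Finset.sum_sigma, tensorSum]
  refine Finset.sum_le_sum fun k _ => ?_
  rw [spectralSum, finrank_euclideanSpace_fin, finrank_euclideanSpace_fin]
  exact Finset.sum_le_sum_of_subset_of_nonneg (hS k) fun i _ _ => sq_nonneg _

/-- Serves only to turn convergence in norm into convergence in the nuclear norm; the size of the
constant is irrelevant. -/
theorem ttnn_le_norm (hU : U ∈ Matrix.unitaryGroup (Fin n₃) ℂ) (V : Tensor n₁ n₂ n₃) :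
    ttnn U V ≤ √((∑ _k : Fin n₃, min n₁ n₂ : ℕ) : ℝ) * ‖V‖ := by
  have h := sum_singularValues_le hU V (fun _ => Finset.range (min n₁ n₂)) fun _ => subset_rfl
  simpa [ttnn_eq_tensorSum, tensorSum, spectralSum] using h

theorem rank_transformedSlice (X : Tensor n₁ n₂ n₃) (k : Fin n₃) :
    finrank ℂ (LinearMap.range (sliceMap U X k)) = (transformedSlice U X k).rank := by
  have h := LinearMap.congr_fun (congrArg LinearEquiv.toLinearMap
    (Matrix.toLpLin_eq_toLin (R := ℂ) (m := Fin n₁) (n := Fin n₂) 2 2)) (transformedSlice U X k)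
  have h' : sliceMap U X k = Matrix.toLin (PiLp.basisFun 2 ℂ (Fin n₂)) (PiLp.basisFun 2 ℂ (Fin n₁))
    (transformedSlice U X k) := h
  rw [h', ← Matrix.rank_eq_finrank_range_toLin]

variable {g : ℝ → ℝ} {lam k₀ μ : ℝ}

theorem regularizer_le_mul_ttnn (hg : PenaltyAssumption g lam k₀ μ) (X : Tensor n₁ n₂ n₃) :
    regularizer U g X ≤ lam * k₀ * ttnn U X := by
  rw [regularizer_eq_tensorSum, ttnn_eq_tensorSum, ← tensorSum_const_mul]
  exact tensorSum_mono U (fun x hx => hg.le_mul hx) X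

theorem mul_ttnn_le_regularizer (hU : U ∈ Matrix.unitaryGroup (Fin n₃) ℂ)
    (hg : PenaltyAssumption g lam k₀ μ) (X : Tensor n₁ n₂ n₃) :
    lam * k₀ * ttnn U X ≤ regularizer U g X + μ / 2 * ‖X‖ ^ 2 := by
  rw [regularizer_eq_tensorSum, ttnn_eq_tensorSum, ← tensorSum_const_mul, ← tensorSum_sq hU,
    ← tensorSum_const_mul, ← tensorSum_add]
  exact tensorSum_mono U (fun x hx => hg.mul_le_add_sq hx) X

/-- Lipschitz bound for the regularizer along a segment. -/
theorem regularizer_add_smul_le (hg : PenaltyAssumption g lam k₀ μ) (hlam : 0 ≤ lam * k₀)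
    (X W : Tensor n₁ n₂ n₃) {s : ℝ} (hs : 0 ≤ s) (hs1 : s ≤ 1) :
    regularizer U g (X + s • W) ≤ regularizer U g X + s * (lam * k₀ * ttnn U W) := by
  have h1 := tensorSum_add_le U hg.concave hg.mono hg.map_zero X (s • W)
  simp only [← regularizer_eq_tensorSum] at h1
  have h2 := regularizer_le_mul_ttnn (U := U) hg (s • W)
  have h3 := mul_le_mul_of_nonneg_left (ttnn_smul_of_nonneg U hs hs1 W) hlam
  linarith

/-- Weak convexity of the regularizer along a segment. -/
theorem regularizer_add_smul_le_of_weakConvex (hU : U ∈ Matrix.unitaryGroup (Fin n₃) ℂ)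
    (hg : PenaltyAssumption g lam k₀ μ) (X W : Tensor n₁ n₂ n₃) {s : ℝ} (hs : 0 ≤ s)
    (hs1 : s ≤ 1) : regularizer U g (X + s • W) ≤ regularizer U g X +
      s * (regularizer U g (X + W) - regularizer U g X + μ / 2 * ‖W‖ ^ 2) := by
  have h := tensorSum_convex U hg.convexOn_add_sq hg.monotoneOn_add_sq (by simp [hg.map_zero])
    X (X + W) (sub_nonneg.2 hs1) hs (by ring)
  rw [show (1 - s) • X + s • (X + W) = X + s • W by
    rw [smul_add, sub_smul, one_smul]; abel] at h
  simp only [tensorSum_add, tensorSum_const_mul, tensorSum_sq hU] at h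
  simp only [← regularizer_eq_tensorSum] at h
  rw [norm_add_sq_real, norm_add_sq_real, norm_smul, inner_smul_right, Real.norm_of_nonneg hs] at h
  -- Comparing the squared norms along the segment leaves (μ/2)(s - s²)‖W‖²; the s² part is
  -- discarded.
  have h2 : 0 ≤ μ * s ^ 2 * ‖W‖ ^ 2 := by
    have := hg.μ_pos
    positivity
  nlinarith

theorem regularizer_sub_add_half_le (hU : U ∈ Matrix.unitaryGroup (Fin n₃) ℂ)
    (hg : PenaltyAssumption g lam k₀ μ) (hlam : 0 ≤ lam * k₀) (X V : Tensor n₁ n₂ n₃) :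
    regularizer U g X - regularizer U g (X + V) + 1 / 2 * regularizer U g V ≤
      3 / 2 * (lam * k₀ * (√(sumTransformedRank U X : ℝ) * ‖V‖)) := by
  let S : Fin n₃ → Finset ℕ := fun k =>
    (Finset.range (min n₁ n₂)).filter (· < finrank ℂ (LinearMap.range (sliceMap U X k)))
  have hS := sum_singularValues_le hU V S fun k => Finset.filter_subset _ _
  have hcard : ∑ k, (S k).card ≤ sumTransformedRank U X := by
    refine Finset.sum_le_sum fun k _ => ?_
    rw [← rank_transformedSlice]
    refine (Finset.card_le_card (t := Finset.range _) fun i hi => ?_).trans_eq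
      (Finset.card_range _)
    simpa using (Finset.mem_filter.1 hi).2
  have hS' : ∑ k, ∑ i ∈ S k, (sliceMap U V k).singularValues i ≤
      √(sumTransformedRank U X : ℝ) * ‖V‖ :=
    hS.trans (mul_le_mul_of_nonneg_right (Real.sqrt_le_sqrt (Nat.cast_le.2 hcard))
      (norm_nonneg V))
  calc regularizer U g X - regularizer U g (X + V) + 1 / 2 * regularizer U g V
      ≤ 3 / 2 * ∑ k, ∑ i ∈ S k, g ((sliceMap U V k).singularValues i) := by
        simp only [regularizer_eq_tensorSum, tensorSum]
        rw [Finset.mul_sum, Finset.mul_sum, ← Finset.sum_sub_distrib, ← Finset.sum_add_distrib]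
        refine Finset.sum_le_sum fun k _ => ?_
        rw [sliceMap_add]
        have := spectralSum_sub_add_half_le hg.concave hg.mono hg.map_zero (sliceMap U X k)
          (sliceMap U V k)
        rwa [finrank_euclideanSpace_fin, finrank_euclideanSpace_fin] at this
    _ ≤ 3 / 2 * (lam * k₀ * ∑ k, ∑ i ∈ S k, (sliceMap U V k).singularValues i) := by
        refine mul_le_mul_of_nonneg_left ?_ (by norm_num)
        rw [Finset.mul_sum]
        refine Finset.sum_le_sum fun k _ => ?_
        rw [Finset.mul_sum]
        exact Finset.sum_le_sum fun i _ => hg.le_mul (LinearMap.singularValues_nonneg _ _)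
    _ ≤ _ := by gcongr

end TensorSum

/-! ### Variational inequalities from regular subgradients -/

section Stationarity

variable {E : Type*} [NormedAddCommGroup E] [InnerProductSpace ℝ E]

theorem mem_of_mem_regularSubdifferential {φ : E → ℝ} {S : Set E} {u v : E}
    (hv : v ∈ regularSubdifferential (fun z => ((φ z : ℝ) : EReal) + setIndicator S z) u) :
    u ∈ S := by
  by_contra h
  exact hv.1 (by simp [setIndicator, h])

/-- Regular subgradients of `φ + δ_S` are dominated by one-sided directional derivatives towards
points of a convex set `S`. -/
theorem inner_le_of_mem_regularSubdifferential {φ : E → ℝ} {S : Set E} (hS : Convex ℝ S) {u v : E}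
    (hv : v ∈ regularSubdifferential (fun z => ((φ z : ℝ) : EReal) + setIndicator S z) u)
    {y : E} (hy : y ∈ S) {q : ℝ → ℝ} {M : ℝ} (hq : Tendsto q (𝓝[>] 0) (𝓝 M))
    (hφ : ∀ᶠ s in 𝓝[>] (0 : ℝ), φ (u + s • (y - u)) - φ u ≤ s * q s) :
    inner ℝ v (y - u) ≤ M := by
  have hu := mem_of_mem_regularSubdifferential hv
  obtain ⟨-, -, hlim⟩ := hv
  by_cases hw : y - u = 0
  · rw [hw, inner_zero_right]
    refine ge_of_tendsto hq ?_
    filter_upwards [hφ, self_mem_nhdsWithin] with s hs hs0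
    rw [hw, smul_zero, add_zero, sub_self] at hs
    exact nonneg_of_mul_nonneg_right hs hs0
  set w := y - u with hwdef
  have hw' : 0 < ‖w‖ := norm_pos_iff.2 hw
  refine le_of_forall_pos_le_add fun δ hδ => ?_
  -- The liminf allows an error ε‖z - u‖; for z = u + sw this is sδ, of the same order in s as the
  -- other terms.
  set ε := δ / ‖w‖ with hε
  have hε0 : 0 < ε := by positivity
  have hev := eventually_lt_of_lt_liminf
    (lt_of_lt_of_le (by exact_mod_cast neg_neg_of_pos hε0 : ((-ε : ℝ) : EReal) < 0) hlim)
  have htend : Tendsto (fun s : ℝ => u + s • w) (𝓝[>] 0) (𝓝[≠] u) := by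
    refine tendsto_nhdsWithin_iff.2 ⟨?_, ?_⟩
    · have : Continuous fun s : ℝ => u + s • w := by fun_prop
      simpa using (this.tendsto 0).mono_left nhdsWithin_le_nhds
    · filter_upwards [self_mem_nhdsWithin] with s hs
      have hs' : (0 : ℝ) < s := hs
      simp [hw, hs'.ne']
  suffices h : ∀ᶠ s in 𝓝[>] (0 : ℝ), inner ℝ v w - δ ≤ q s by
    linarith [ge_of_tendsto hq h]
  filter_upwards [htend.eventually hev, hφ, Ioc_mem_nhdsGT one_pos] with s h1 h2 h3
  have hz : u + s • w ∈ S := hS.add_smul_sub_mem hu hy ⟨h3.1.le, h3.2⟩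
  simp only [setIndicator, hz, hu, if_true, add_zero, add_sub_cancel_left] at h1
  rw [← EReal.coe_sub, ← EReal.coe_sub, ← EReal.coe_div, EReal.coe_lt_coe_iff, norm_smul,
    Real.norm_of_nonneg h3.1.le, inner_smul_right,
    lt_div_iff₀ (mul_pos h3.1 hw')] at h1
  have h4 : ε * ‖w‖ = δ := by rw [hε]; field_simp
  have h5 : s * (inner ℝ v w - δ) < s * q s := by
    rw [← h4]
    linarith
  exact (lt_of_mul_lt_mul_left h5 h3.1.le).le

/-- Variational inequality for a differentiable function plus a function that is bounded by a linear
function along the segment. -/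
theorem inner_le_inner_gradient_add [CompleteSpace E] {f G : E → ℝ} {β : ℝ} (hβ : 0 ≤ β)
    {S : Set E} (hS : Convex ℝ S) {u v : E} (hf : DifferentiableAt ℝ f u)
    (hv : v ∈ regularSubdifferential
      (fun z => ((f z + β * G z : ℝ) : EReal) + setIndicator S z) u)
    {y : E} (hy : y ∈ S) {M : ℝ}
    (hG : ∀ s : ℝ, 0 ≤ s → s ≤ 1 → G (u + s • (y - u)) ≤ G u + s * M) :
    inner ℝ v (y - u) ≤ inner ℝ (gradient f u) (y - u) + β * M := by
  have hd : HasDerivAt (fun s : ℝ => f (u + s • (y - u))) (inner ℝ (gradient f u) (y - u)) 0 := by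
    have h1 : HasFDerivAt f (InnerProductSpace.toDual ℝ E (gradient f u))
        (u + (0 : ℝ) • (y - u)) := by
      simpa using hf.hasGradientAt.hasFDerivAt
    have h2 : HasDerivAt (fun s : ℝ => u + s • (y - u)) (y - u) 0 := by
      simpa using ((hasDerivAt_id (0 : ℝ)).smul_const (y - u)).const_add u
    exact h1.comp_hasDerivAt (0 : ℝ) h2
  refine inner_le_of_mem_regularSubdifferential hS hv hy
    (q := fun s => s⁻¹ * (f (u + s • (y - u)) - f u) + β * M) ?_ ?_
  · have h := hd.tendsto_slope_zero_right
    simp only [zero_add, zero_smul, add_zero, smul_eq_mul] at h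
    exact h.add_const _
  · filter_upwards [Ioc_mem_nhdsGT one_pos] with s hs
    have h1 := mul_le_mul_of_nonneg_left (hG s hs.1.le hs.2) hβ
    have h2 : s * (s⁻¹ * (f (u + s • (y - u)) - f u)) = f (u + s • (y - u)) - f u :=
      mul_inv_cancel_left₀ hs.1.ne' _
    rw [mul_add, h2]
    linarith

end Stationarity

/-! ### Convexity of the feasible sets -/

section Constraint

variable {n₁ n₂ n₃ : ℕ}

theorem tensorInfNorm_le_iff {c : ℝ} (hc : 0 ≤ c) (X : Tensor n₁ n₂ n₃) :
    tensorInfNorm X ≤ c ↔ ∀ p, |X p| ≤ c :=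
  ⟨fun h p => (le_ciSup (Set.finite_range _).bddAbove p).trans h, fun h => Real.iSup_le h hc⟩

theorem convex_setOf_tensorInfNorm_le {c : ℝ} (hc : 0 ≤ c) :
    Convex ℝ {X : Tensor n₁ n₂ n₃ | tensorInfNorm X ≤ c} := by
  intro X hX Y hY a b ha hb hab
  simp only [Set.mem_ofPred_eq, tensorInfNorm_le_iff hc] at hX hY ⊢
  intro p
  calc |(a • X + b • Y) p| = |a * X p + b * Y p| := rfl
    _ ≤ |a * X p| + |b * Y p| := abs_add_le _ _
    _ = a * |X p| + b * |Y p| := by rw [abs_mul, abs_mul, abs_of_nonneg ha, abs_of_nonneg hb]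
    _ ≤ a * c + b * c :=
        add_le_add (mul_le_mul_of_nonneg_left (hX p) ha) (mul_le_mul_of_nonneg_left (hY p) hb)
    _ = c := by rw [← add_mul, hab, one_mul]

theorem convex_setOf_ttnn_le (U : Matrix (Fin n₃) (Fin n₃) ℂ) (t : ℝ) :
    Convex ℝ {X : Tensor n₁ n₂ n₃ | ttnn U X ≤ t} := by
  intro X hX Y hY a b ha hb hab
  simp only [Set.mem_ofPred_eq] at hX hY ⊢
  have h := tensorSum_convex U (h := id) (convexOn_id (convex_Ici 0)) (monotone_id.monotoneOn _) rfl
    X Y ha hb hab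
  simp only [← ttnn_eq_tensorSum] at h
  calc ttnn U (a • X + b • Y) ≤ a * ttnn U X + b * ttnn U Y := h
    _ ≤ a * t + b * t :=
        add_le_add (mul_le_mul_of_nonneg_left hX ha) (mul_le_mul_of_nonneg_left hY hb)
    _ = t := by rw [← add_mul, hab, one_mul]

end Constraint

/-! ### Error bound at a point with a small regular subgradient -/

section ErrorBound

variable {n₁ n₂ n₃ : ℕ} {U : Matrix (Fin n₃) (Fin n₃) ℂ}

/-- The error bound at a point with a small regular subgradient. -/
theorem norm_sub_le_of_mem_regularSubdifferential (hU : U ∈ Matrix.unitaryGroup (Fin n₃) ℂ)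
    {f : Tensor n₁ n₂ n₃ → ℝ} (hf : Differentiable ℝ f) {g : ℝ → ℝ} {lam k₀ μ : ℝ}
    (hg : PenaltyAssumption g lam k₀ μ) {β t ρ : ℝ} (hβ : 0 < β) (ht : 0 < t) (hρ : 0 ≤ ρ)
    {Xstar : Tensor n₁ n₂ n₃} {α₁ α₂ τ₁ τ₂ : ℝ} (hα₂ : 0 < α₂) (hτ₁ : 0 ≤ τ₁) (hτ₂ : 0 ≤ τ₂)
    {S : Set (Tensor n₁ n₂ n₃)} (hS : Convex ℝ S) (hXS : Xstar ∈ S) {u v : Tensor n₁ n₂ n₃}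
    (hsmall : ‖u - Xstar‖ ≤ 1 → α₁ * ‖u - Xstar‖ ^ 2 - τ₁ * ρ ^ 2 * ttnn U (u - Xstar) ^ 2 ≤
      inner ℝ (gradient f u - gradient f Xstar) (u - Xstar))
    (hlarge : 1 < ‖u - Xstar‖ → α₂ * ‖u - Xstar‖ - τ₂ * ρ * ttnn U (u - Xstar) ≤
      inner ℝ (gradient f u - gradient f Xstar) (u - Xstar))
    (hD : tensorSpectralNorm U (gradient f Xstar) ≤ β * (lam * k₀) / 4)
    (hρlam : α₂ * ρ ≤ β * (lam * k₀) / 4) (hlam : β * (lam * k₀) * (6 * t) ≤ α₂)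
    (hτ₁ρ : τ₁ * ρ * (4 * t) ≤ α₂) (hτ₂ρ : τ₂ * ρ * (4 * t) ≤ α₂)
    (hv : v ∈ regularSubdifferential
      (fun z => ((f z + β * regularizer U g z : ℝ) : EReal) + setIndicator S z) u)
    (hvα : ‖v‖ ≤ α₂ / 32) (hT : ttnn U (u - Xstar) ≤ 45 / 22 * t) :
    (α₁ - 3 / 4 * β * μ) * ‖u - Xstar‖ ≤
      3 / 2 * β * (lam * k₀) * √(sumTransformedRank U Xstar : ℝ) + ‖v‖ := by
  set V := u - Xstar with hV
  have hW : Xstar - u = -V := by rw [hV]; abel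
  have huV : Xstar + V = u := by rw [hV]; abel
  have hTn : 0 ≤ ttnn U V := ttnn_nonneg U V
  set T := ttnn U V with hTdef
  set L := lam * k₀ with hL
  have hL0 : 0 ≤ L := by
    have h1 := (mul_nonneg hα₂.le hρ).trans hρlam
    have h2 : 0 ≤ β * L := by linarith
    exact nonneg_of_mul_nonneg_right h2 hβ
  have hvar1 := inner_le_inner_gradient_add hβ.le hS (hf u) hv hXS (M := L * T) (fun s hs hs1 => by
    have := regularizer_add_smul_le (U := U) hg hL0 u (Xstar - u) hs hs1
    rwa [hW, ttnn_neg, ← hW] at this)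
  have hvar2 := inner_le_inner_gradient_add hβ.le hS (hf u) hv hXS
    (M := regularizer U g Xstar - regularizer U g u + μ / 2 * ‖V‖ ^ 2) (fun s hs hs1 => by
    have := regularizer_add_smul_le_of_weakConvex hU hg u (Xstar - u) hs hs1
    rwa [add_sub_cancel, norm_sub_rev] at this)
  rw [hW, inner_neg_right, inner_neg_right] at hvar1 hvar2
  have hvV := real_inner_le_norm v V
  have hdual := (neg_abs_le _).trans' (neg_le_neg (abs_inner_le hU (gradient f Xstar) V))
  have hDT := mul_le_mul_of_nonneg_right hD hTn
  rw [inner_sub_left] at hsmall hlarge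
  have hn := norm_nonneg V
  have hV1 : ‖V‖ ≤ 1 := by
    by_contra hV1
    push Not at hV1
    have h1 := hlarge hV1
    have h2 : α₂ * ‖V‖ ≤ (τ₂ * ρ + 5 / 4 * (β * L)) * T + ‖v‖ * ‖V‖ := by linarith
    have h3 : (τ₂ * ρ + 5 / 4 * (β * L)) * T ≤ (τ₂ * ρ + 5 / 4 * (β * L)) * (45 / 22 * t) :=
      mul_le_mul_of_nonneg_left hT (by positivity)
    -- From τ₂ρt ≤ α₂/4 and βLt ≤ α₂/6 the factor is (1/4 + 5/24)·45/22 = 15/16. With ‖v‖ ≤ α₂/32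
    -- this gives (31/32)‖V‖ ≤ 30/32, contradicting ‖V‖ > 1.
    have h4 : (τ₂ * ρ + 5 / 4 * (β * L)) * (45 / 22 * t) ≤ 15 / 16 * α₂ := by
      linarith
    have h5 := mul_le_mul_of_nonneg_right hvα hn
    have h6 := mul_lt_mul_of_pos_left hV1 hα₂
    linarith
  have h1 := hsmall hV1
  -- One factor ρT of the quadratic tolerance is absorbed through T ≤ 4t, the other through the
  -- lower bound on λ.
  have h2 : τ₁ * ρ ^ 2 * T ^ 2 ≤ β * L / 4 * T := by
    calc τ₁ * ρ ^ 2 * T ^ 2 = (τ₁ * ρ * T) * (ρ * T) := by ring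
      _ ≤ α₂ * (ρ * T) := by
        refine mul_le_mul_of_nonneg_right ?_ (by positivity)
        exact (mul_le_mul_of_nonneg_left (by linarith) (by positivity)).trans hτ₁ρ
      _ = (α₂ * ρ) * T := by ring
      _ ≤ β * L / 4 * T := mul_le_mul_of_nonneg_right hρlam hTn
  have h3 := mul_le_mul_of_nonneg_left (mul_ttnn_le_regularizer hU hg V) hβ.le
  have h4 := mul_le_mul_of_nonneg_left (regularizer_sub_add_half_le hU hg hL0 Xstar V) hβ.le
  rw [huV] at h4
  set r := √(sumTransformedRank U Xstar : ℝ) with hr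
  have hr0 : 0 ≤ r := Real.sqrt_nonneg _
  have h5 : (α₁ - 3 / 4 * β * μ) * ‖V‖ * ‖V‖ ≤ (3 / 2 * β * L * r + ‖v‖) * ‖V‖ := by
    rw [← hL] at h3 h4
    rw [← hTdef] at h3
    linarith
  rcases hn.eq_or_lt with h6 | h6
  · rw [← h6, mul_zero]
    positivity
  · exact le_of_mul_le_mul_right h5 h6

end ErrorBound

end LowRankTensor

end

/-! ### Passage to the limit along regular subgradients -/

theorem theorem2p1 {n₁ n₂ n₃ : ℕ}
    (U : Matrix (Fin n₃) (Fin n₃) ℂ) (hU : U ∈ Matrix.unitaryGroup (Fin n₃) ℂ)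
    (n : ℕ) (hn : 0 < n)
    (f : LowRankTensor.Tensor n₁ n₂ n₃ → ℝ) (hf : Differentiable ℝ f)
    (g : ℝ → ℝ) (lam k₀ μ : ℝ) (hg : LowRankTensor.PenaltyAssumption g lam k₀ μ)
    (β c t : ℝ) (hβ : 0 < β) (hc : 0 < c) (ht : 0 < t)
    (Xstar : LowRankTensor.Tensor n₁ n₂ n₃)
    (hXstar_inf : LowRankTensor.tensorInfNorm Xstar ≤ c)
    (hXstar_ttnn : LowRankTensor.ttnn U Xstar ≤ t)
    (α₁ α₂ τ₁ τ₂ : ℝ) (hα₁ : 0 < α₁) (hα₂ : 0 < α₂) (hτ₁ : 0 ≤ τ₁) (hτ₂ : 0 ≤ τ₂)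
    (hRSC : LowRankTensor.RestrictedStrongConvexity U f Xstar n α₁ α₂ τ₁ τ₂)
    (hμ : 3 / 4 * β * μ < α₁)
    (hlam_lower : 4 / (β * k₀) *
        max (LowRankTensor.tensorSpectralNorm U (gradient f Xstar))
          (α₂ * √(Real.log ((n₁ * n₂ * n₃ : ℕ) : ℝ) / n)) ≤ lam)
    (hlam_upper : lam ≤ α₂ / (6 * t * β * k₀))
    (hn_lower : 16 * t ^ 2 * max (τ₁ ^ 2) (τ₂ ^ 2) / α₂ ^ 2 *
        Real.log ((n₁ * n₂ * n₃ : ℕ) : ℝ) ≤ n)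
    (Xtilde : LowRankTensor.Tensor n₁ n₂ n₃)
    (hXtilde_ttnn : LowRankTensor.ttnn U Xtilde ≤ t)
    -- stationarity for the constraint `‖X‖_∞ ≤ c`, or for `‖X‖_∞ ≤ c` and `‖X‖_TTNN ≤ t`
    (hstat :
      LowRankTensor.IsStationaryPoint
        (fun X => f X + β * LowRankTensor.regularizer U g X)
        {X | LowRankTensor.tensorInfNorm X ≤ c} Xtilde ∨
      LowRankTensor.IsStationaryPoint
        (fun X => f X + β * LowRankTensor.regularizer U g X)
        {X | LowRankTensor.tensorInfNorm X ≤ c ∧ LowRankTensor.ttnn U X ≤ t} Xtilde) :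
    ‖Xtilde - Xstar‖ ≤
      6 * β * lam * k₀ * √(LowRankTensor.sumTransformedRank U Xstar : ℝ) /
        (4 * α₁ - 3 * β * μ) := by

  open LowRankTensor in
  set d : ℝ := ((n₁ * n₂ * n₃ : ℕ) : ℝ) with hd
  set ρ : ℝ := √(Real.log d / n) with hρdef
  have hn' : (0 : ℝ) < n := Nat.cast_pos.2 hn
  have hlog : 0 ≤ Real.log d := Real.log_natCast_nonneg _
  have hρ : 0 ≤ ρ := Real.sqrt_nonneg _
  have hρsq : ρ ^ 2 = Real.log d / n := Real.sq_sqrt (by positivity)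
  have hk := hg.k₀_pos
  have hβk : 0 < β * k₀ := mul_pos hβ hk
  have hmax : max (tensorSpectralNorm U (gradient f Xstar)) (α₂ * ρ) ≤ β * (lam * k₀) / 4 := by
    rw [div_mul_eq_mul_div, div_le_iff₀ hβk] at hlam_lower
    linarith
  have hlam : β * (lam * k₀) * (6 * t) ≤ α₂ := by
    rw [le_div_iff₀ (by positivity)] at hlam_upper
    linarith
  have hτρ : ∀ τ : ℝ, 0 ≤ τ → τ ^ 2 ≤ max (τ₁ ^ 2) (τ₂ ^ 2) → τ * ρ * (4 * t) ≤ α₂ := by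
    intro τ hτ hle
    refine le_of_sq_le_sq ?_ hα₂.le
    rw [div_mul_eq_mul_div, div_le_iff₀ (by positivity)] at hn_lower
    rw [mul_pow, mul_pow, hρsq, mul_div_assoc', div_mul_eq_mul_div, div_le_iff₀ hn']
    have := mul_le_mul_of_nonneg_right hle (mul_nonneg hlog (sq_nonneg (4 * t)))
    linarith
  -- Only convexity of the feasible set and feasibility of X* matter, so both kinds of stationary
  -- point are treated together.
  obtain ⟨S, hS, hXS, hstat'⟩ : ∃ S : Set (Tensor n₁ n₂ n₃), Convex ℝ S ∧ Xstar ∈ S ∧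
      IsStationaryPoint (fun X => f X + β * regularizer U g X) S Xtilde := by
    rcases hstat with h | h
    · exact ⟨_, convex_setOf_tensorInfNorm_le hc.le, hXstar_inf, h⟩
    · exact ⟨_, (convex_setOf_tensorInfNorm_le hc.le).inter (convex_setOf_ttnn_le U t),
        ⟨hXstar_inf, hXstar_ttnn⟩, h⟩
  obtain ⟨-, -, u, v, hu, -, hv, huv⟩ := hstat'
  have hvn : Tendsto (fun k => ‖v k‖) atTop (𝓝 0) := by simpa using hv.norm
  have hun : Tendsto (fun k => √((∑ _k : Fin n₃, min n₁ n₂ : ℕ) : ℝ) * ‖u k - Xtilde‖) atTop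
      (𝓝 0) := by
    simpa using ((hu.sub_const Xtilde).norm).const_mul (√((∑ _k : Fin n₃, min n₁ n₂ : ℕ) : ℝ))
  have hev : ∀ᶠ k in atTop, (α₁ - 3 / 4 * β * μ) * ‖u k - Xstar‖ ≤
      3 / 2 * β * (lam * k₀) * √(sumTransformedRank U Xstar : ℝ) + ‖v k‖ := by
    -- The approximating points need not satisfy the nuclear norm bound t themselves. A slack of
    -- t/22 gives 2t + t/22 = 45t/22, small enough to exclude the large-scale case.
    filter_upwards [hvn.eventually_le_const (show 0 < α₂ / 32 by positivity),
      hun.eventually_le_const (show 0 < 1 / 22 * t by positivity)] with k hvk huk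
    have hrsc := hRSC (u k - Xstar)
    rw [add_sub_cancel, ← hd, ← hρdef, ← hρsq] at hrsc
    refine norm_sub_le_of_mem_regularSubdifferential hU hf hg hβ ht hρ hα₂ hτ₁ hτ₂ hS hXS
      hrsc.1 hrsc.2 ((le_max_left _ _).trans hmax) ((le_max_right _ _).trans hmax) hlam
      (hτρ τ₁ hτ₁ (le_max_left _ _)) (hτρ τ₂ hτ₂ (le_max_right _ _)) (huv k) hvk ?_
    have h1 := ttnn_add_le U (u k - Xtilde) (Xtilde + -Xstar)
    have h2 := ttnn_add_le U Xtilde (-Xstar)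
    rw [show u k - Xtilde + (Xtilde + -Xstar) = u k - Xstar by abel] at h1
    rw [ttnn_neg] at h2
    have h3 := ttnn_le_norm hU (u k - Xtilde)
    linarith
  have hlim := le_of_tendsto_of_tendsto
    (((hu.sub_const Xstar).norm).const_mul (α₁ - 3 / 4 * β * μ)) (hvn.const_add _) hev
  rw [le_div_iff₀ (by linarith)]
  linarith
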